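/- Let $w>0$. For a modulus $0\le k\le 1$ and real $u$, let $\mathrm{sn}(u;k)$, $\mathrm{cn}(u;k)$, $\mathrm{dn}(u;k)$ be the Jacobi elliptic functions, and for $0<k<1$ let $K(k)=\int_0^{\pi/2}\frac{dt}{\sqrt{1-k^2\sin^2 t}}$ and $K'(k)=K(\sqrt{1-k^2})$. Put $E^n_j=\prod_{s=0}^{j-1}\frac{\mathrm{sn}(w(n-s);k)}{\mathrm{sn}(w(s+1);k)}$ for $0\le j\le n$. The cn-polynomials are $\Phi_n^{(C)}(z)=\sum_{s=0}^n W_{ns}z^s$ with $W_{ns}=(-1)^s\,\mathrm{dn}(w(n-s);k)\,E^n_s$ for even $n$ and $W_{ns}=(-1)^{s+1}\,\mathrm{cn}(w(n-s);k)\,E^n_s$ for odd $n$; the dn-polynomials $\Phi_n^{(D)}$ are obtained by interchanging $\mathrm{cn}$ and $\mathrm{dn}$ in these coefficients. (a) For $k=1$ the two families coincide, $\Phi_n^{(C)}=\Phi_n^{(D)}=:\Phi_n$, and for every $n$ the coefficients of both $\Phi_n^{(C)}$ and $\Phi_n^{(D)}$ tend to those of $\Phi_n$ as $k\to1^-$.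 The quantities $\mathrm{cn}(wm;k)$ and $\mathrm{dn}(wm;k)$, $m\in\mathbb Z$, both equal $1/\cosh(wm)$ at $k=1$ and tend to it as $k\to 1^-$. The polynomial $\Phi_n$ is monic of degree $n$, with reflection parameters $a_n=-\Phi_{n+1}(0)=(-1)^n/\cosh(w(n+1))$. A real sequence $(c_m)_{m\in\mathbb Z}$ satisfies $c_0=1$, $c_{-m}=c_m$ and, for the linear functional $\mathcal L$ on Laurent polynomials with $\mathcal L\{z^m\}=c_m$, the conditions $\mathcal L\{\Phi_n(z)z^{-j}\}=0$ for $0\le j<n$ and $\mathcal L\{\Phi_n(z)z^{-n}\}\ne0$ for all $n\ge 0$, if and only if $c_m=1/\cosh(wm)$ for all $m$. (b) With $q=e^{-2w}$, for all $n\ge0$ and $z\in\mathbb C$, $$\Phi_n(z)=\frac{2(-1)^n q^{-n/2}}{1+q^{-n}}\;{}_2\phi_1\!\left({q^{-n},\,-q\atop -q^{1-n}};q,\;zq^{1/2}\right),\qquad {}_2\phi_1\!\left({\alpha,\beta\atop\gamma};q,z\right)=\sum_{s\ge0}\frac{(\alpha;q)_s(\beta;q)_s}{(q;q)_s(\gamma;q)_s}z^s,$$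 where $(a;q)_s=\prod_{i=0}^{s-1}(1-aq^i)$. (c) There is exactly one $k\in(0,1)$ with $w=\pi K'(k)/K(k)$. For this $k$ the function $$\rho(\theta)=\frac{K(k)}{\pi^2}\,\mathrm{dn}\!\left(\frac{K(k)\theta}{\pi};k\right)$$ is continuous and positive, satisfies $\rho(2\pi-\theta)=\rho(\theta)$, and $$\int_0^{2\pi}\rho(\theta)\cos(m\theta)\,d\theta=\frac1{\cosh(wm)}\quad(m\in\mathbb Z),\qquad \int_0^{2\pi}\Phi_n(e^{i\theta})\Phi_m(e^{-i\theta})\rho(\theta)\,d\theta=\delta_{nm}\prod_{j=1}^n\tanh^2(wj)\quad(n,m\ge 0).$$ Moreover $\rho(\theta)\,d\theta$ is the only finite positive Borel measure $\mu$ on the unit circle with $\int z^m\,d\mu=1/\cosh(wm)$ for all $m\in\mathbb Z$. -/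

import Mathlib

open Filter Topology MeasureTheory Polynomial

noncomputable section

/-- The integrand `1 / √(1 - k² sin² t)` of the elliptic integral of the first kind. -/
def ellipticIntegrand (k t : ℝ) : ℝ := 1 / Real.sqrt (1 - k ^ 2 * Real.sin t ^ 2)

/-- The complete elliptic integral of the first kind `K(k)`. -/
def ellipticK (k : ℝ) : ℝ := ∫ t in (0 : ℝ)..(Real.pi / 2), ellipticIntegrand k t

/-- The complementary integral `K'(k) = K(k')`, where `k'² = 1 - k²`. -/
def ellipticK' (k : ℝ) : ℝ := ellipticK (Real.sqrt (1 - k ^ 2))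

/-- The Jacobi amplitude `am(u; k)` for a real argument `u` and a modulus `0 ≤ k ≤ 1`: the inverse
of the incomplete elliptic integral of the first kind, i.e. the unique `φ` with
`u = ∫₀^φ dt / √(1 - k² sin² t)`. Integrability is required explicitly: it holds for all `φ`
when `0 ≤ k < 1`, and exactly for `|φ| < π/2` when `k = 1`. -/
def jacobiAm (k u : ℝ) : ℝ :=
  Classical.epsilon fun φ : ℝ =>
    IntervalIntegrable (ellipticIntegrand k) volume 0 φ ∧
      (∫ t in (0 : ℝ)..φ, ellipticIntegrand k t) = u

/-- The Jacobi elliptic function `sn(u; k)`. -/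
def jacobiSn (k u : ℝ) : ℝ := Real.sin (jacobiAm k u)

/-- The Jacobi elliptic function `cn(u; k)`. -/
def jacobiCn (k u : ℝ) : ℝ := Real.cos (jacobiAm k u)

/-- The Jacobi elliptic function `dn(u; k)`. -/
def jacobiDn (k u : ℝ) : ℝ := Real.sqrt (1 - k ^ 2 * jacobiSn k u ^ 2)

/-- The elliptic binomial coefficient `E_j^n`, which vanishes for `j > n`. -/
def ellipticBinom (k w : ℝ) (n j : ℕ) : ℝ :=
  if j ≤ n then
    ∏ s ∈ Finset.range j,
      jacobiSn k (w * ((n : ℝ) - (s : ℝ))) / jacobiSn k (w * ((s : ℝ) + 1))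
  else 0

/-- The cn-polynomials: `W_{ns} = (-1)^s dn(w(n-s)) E_s^n` for even `n`, and
`W_{ns} = (-1)^{s+1} cn(w(n-s)) E_s^n` for odd `n`. -/
def cnPoly (k w : ℝ) (n : ℕ) : ℝ[X] :=
  ∑ s ∈ Finset.range (n + 1),
    Polynomial.monomial s
      (if Even n then
        (-1 : ℝ) ^ s * jacobiDn k (w * ((n : ℝ) - (s : ℝ))) * ellipticBinom k w n s
      else
        (-1 : ℝ) ^ (s + 1) * jacobiCn k (w * ((n : ℝ) - (s : ℝ))) * ellipticBinom k w n s)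

/-- The dn-polynomials: as the cn-polynomials, with `cn` and `dn` interchanged. -/
def dnPoly (k w : ℝ) (n : ℕ) : ℝ[X] :=
  ∑ s ∈ Finset.range (n + 1),
    Polynomial.monomial s
      (if Even n then
        (-1 : ℝ) ^ s * jacobiCn k (w * ((n : ℝ) - (s : ℝ))) * ellipticBinom k w n s
      else
        (-1 : ℝ) ^ (s + 1) * jacobiDn k (w * ((n : ℝ) - (s : ℝ))) * ellipticBinom k w n s)

/-- `L{p(z) z^{-j}}` for the linear functional `L` on Laurent polynomials with
moments `L{z^m} = c m`. -/
def momentFunctional (c : ℤ → ℝ) (p : ℝ[X]) (j : ℕ) : ℝ :=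
  p.sum fun s a => a * c ((s : ℤ) - (j : ℤ))

/-- `c` is a normalized real symmetric sequence of moments for which the polynomials `P n` are
orthogonal: `L{P_n(z) z^{-j}} = h_n δ_{nj}` for `0 ≤ j ≤ n`, with nonzero `h_n`. -/
def IsMomentSequence (P : ℕ → ℝ[X]) (c : ℤ → ℝ) : Prop :=
  c 0 = 1 ∧ (∀ m : ℤ, c (-m) = c m) ∧
    ∀ n : ℕ, (∀ j : ℕ, j < n → momentFunctional c (P n) j = 0) ∧
      momentFunctional c (P n) n ≠ 0

/-- The `q`-shifted factorial `(a; q)_n = (1 - a)(1 - aq) ⋯ (1 - aq^{n-1})`. -/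
def qShiftedFactorial (q a : ℂ) (n : ℕ) : ℂ := ∏ i ∈ Finset.range n, (1 - a * q ^ i)

/-- The basic hypergeometric series `₂φ₁(α, β; γ; q, z)`. -/
def basicHypergeom21 (q α β γ z : ℂ) : ℂ :=
  ∑' s : ℕ, qShiftedFactorial q α s * qShiftedFactorial q β s /
    (qShiftedFactorial q q s * qShiftedFactorial q γ s) * z ^ s

/-- The measure `ρ(θ) dθ`, `0 < θ ≤ 2π`, on the unit circle, as a measure on `ℂ` carried by it. -/
def circleWeightMeasure (ρ : ℝ → ℝ) : Measure ℂ :=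
  ((volume.restrict (Set.Ioc 0 (2 * Real.pi))).withDensity
    (fun θ => ENNReal.ofReal (ρ θ))).map (fun θ : ℝ => Complex.exp ((θ : ℂ) * Complex.I))

/-- The weight `ρ(θ) = (K(k)/π²) dn(K(k)θ/π; k)`. -/
def dnWeight (k θ : ℝ) : ℝ :=
  ellipticK k / Real.pi ^ 2 * jacobiDn k (ellipticK k * θ / Real.pi)

end

/-! # The limit `k → 1` of the cn- and dn-polynomials

*Polynomials.* At `k = 1` one has `sn = tanh` and `cn = dn = 1 / cosh`, so with
`T_n = ∏_{j=1}^n tanh(wj)` the coefficients become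
`W_{ns} = (-1)^{n+s} T_n / (T_s T_{n-s} cosh(w(n-s)))` (`limitCoeff`). The subtraction formula for
`tanh` gives the recurrence `Φ_{n+1}(z) = z Φ_n(z) - a_n z^n Φ_n(1/z)`, and from it, by induction on
`n`, the factorization `∑_s W_{ns} / cosh(ws - y) = T_n ∏_{l<n} sinh(y - wl) / ∏_{s≤n} cosh(y - ws)`
(`sum_limitCoeff_div_cosh`). At `y = wj` the left side is `L{Φ_n(z) z^{-j}}` for the moments
`1 / cosh(wm)`: it vanishes for `j < n` and equals `T_n²` for `j = n`. Since the polynomials are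
monic, the orthogonality conditions determine the moments recursively. The hypergeometric form
follows by comparing ratios of consecutive coefficients.

*Weight.* Let `F(z) = ∑_{n ∈ ℤ} e^{nz} / cosh(wn)`, `|Re z| < w` (`sechSeries`). The addition formulas
for `sinh` and `cosh` make the Fourier coefficients of `F²` and `F³` telescoping sums, which gives
`F³ = 2 F'' + c F` (`sechSeries_pow_three_eq`). On the imaginary axis `f(θ) = F(iθ)` thus satisfies
the differential equation of a scaled `dn`: with the amplitude `φ = ½ ∫₀ f`, one finds
`f² = A cos² φ + B sin² φ` (`sq_eq_of_cubic_ode`), where `A = f(0)²` and `0 < B < A`. With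
`k² = 1 - B / A` this says that `F(k, φ(θ)) = ½ √A θ` for the elliptic integral `F(k, ·)`. The mean
value of `f` is one, so `φ(π) = π / 2` and `K(k) = ½ √A π`, and the Fourier expansion of `dn` results
(`dnWeight_sechModulus`). On the real axis `g(τ) = F(τ)` increases from `√A` to infinity on `[0, w)`,
and the same equation shows that this takes the time `w = K'(k) / (½ √A)` (`ellipticK'_sechModulus`).
Hence `w = π K'(k) / K(k)`; the modulus is unique since `K` is strictly increasing. The measure is
determined by its moments because trigonometric polynomials are dense in the continuous functions
on the circle (`addCircle_measure_ext`).
-/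

/-! ### The incomplete elliptic integral and the Jacobi amplitude -/

/-- The incomplete elliptic integral of the first kind `F(k, φ)`. -/
noncomputable def ellipticF (k φ : ℝ) : ℝ := ∫ t in (0 : ℝ)..φ, ellipticIntegrand k t

lemma sq_mul_sin_sq_lt_one {k : ℝ} (hk : k ^ 2 < 1) (t : ℝ) : k ^ 2 * Real.sin t ^ 2 < 1 := by
  nlinarith [Real.sin_sq_le_one t, sq_nonneg k, sq_nonneg (Real.sin t)]

lemma continuous_ellipticIntegrand {k : ℝ} (hk : k ^ 2 < 1) :
    Continuous (ellipticIntegrand k) := by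
  unfold ellipticIntegrand
  refine continuous_const.div (by fun_prop) fun t => ?_
  have := sq_mul_sin_sq_lt_one hk t
  exact (Real.sqrt_pos.2 (by linarith)).ne'

lemma intervalIntegrable_ellipticIntegrand {k : ℝ} (hk : k ^ 2 < 1) (a b : ℝ) :
    IntervalIntegrable (ellipticIntegrand k) volume a b :=
  (continuous_ellipticIntegrand hk).intervalIntegrable a b

lemma hasDerivAt_ellipticF {k : ℝ} (hk : k ^ 2 < 1) (φ : ℝ) :
    HasDerivAt (ellipticF k) (ellipticIntegrand k φ) φ :=
  (continuous_ellipticIntegrand hk).integral_hasStrictDerivAt 0 φ |>.hasDerivAt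

lemma one_le_ellipticIntegrand {k : ℝ} (hk : k ^ 2 < 1) (t : ℝ) : 1 ≤ ellipticIntegrand k t := by
  have h := sq_mul_sin_sq_lt_one hk t
  unfold ellipticIntegrand
  rw [le_div_iff₀ (Real.sqrt_pos.2 (by linarith)), one_mul]
  refine Real.sqrt_le_one.2 ?_
  nlinarith [sq_nonneg k, sq_nonneg (Real.sin t), mul_nonneg (sq_nonneg k) (sq_nonneg (Real.sin t))]

lemma strictMono_ellipticF {k : ℝ} (hk : k ^ 2 < 1) : StrictMono (ellipticF k) :=
  strictMono_of_deriv_pos fun φ => by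
    rw [(hasDerivAt_ellipticF hk φ).deriv]
    exact zero_lt_one.trans_le (one_le_ellipticIntegrand hk φ)

lemma continuous_ellipticF {k : ℝ} (hk : k ^ 2 < 1) : Continuous (ellipticF k) :=
  continuous_iff_continuousAt.2 fun φ => (hasDerivAt_ellipticF hk φ).continuousAt

@[simp] lemma ellipticF_zero (k : ℝ) : ellipticF k 0 = 0 := by simp [ellipticF]

lemma surjective_ellipticF {k : ℝ} (hk : k ^ 2 < 1) : Function.Surjective (ellipticF k) := by
  have hmono : Monotone fun φ => ellipticF k φ - φ := by
    refine monotone_of_deriv_nonneg (fun φ => ?_) fun φ => ?_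
    · exact ((hasDerivAt_ellipticF hk φ).sub (hasDerivAt_id φ)).differentiableAt
    · have := ((hasDerivAt_ellipticF hk φ).sub (hasDerivAt_id' φ)).deriv
      change 0 ≤ deriv (ellipticF k - fun φ => φ) φ
      rw [this]
      linarith [one_le_ellipticIntegrand hk φ]
  refine (continuous_ellipticF hk).surjective ?_ ?_
  · refine tendsto_atTop_mono' _ ?_ tendsto_id
    filter_upwards [eventually_ge_atTop (0 : ℝ)] with φ hφ
    have := hmono hφ
    simp at this
    simpa using this
  · refine tendsto_atBot_mono' _ ?_ tendsto_id
    filter_upwards [eventually_le_atBot (0 : ℝ)] with φ hφ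
    have := hmono hφ
    simp at this
    simpa using this

/-- For `k² < 1` the amplitude is a right inverse of the incomplete elliptic integral. -/
lemma ellipticF_jacobiAm {k : ℝ} (hk : k ^ 2 < 1) (u : ℝ) : ellipticF k (jacobiAm k u) = u := by
  obtain ⟨φ, hφ⟩ := surjective_ellipticF hk u
  exact (Classical.epsilon_spec (p := fun φ : ℝ =>
    IntervalIntegrable (ellipticIntegrand k) volume 0 φ ∧
      (∫ t in (0 : ℝ)..φ, ellipticIntegrand k t) = u)
    ⟨φ, intervalIntegrable_ellipticIntegrand hk _ _, hφ⟩).2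

lemma jacobiAm_ellipticF {k : ℝ} (hk : k ^ 2 < 1) (φ : ℝ) : jacobiAm k (ellipticF k φ) = φ :=
  (strictMono_ellipticF hk).injective (ellipticF_jacobiAm hk _)

lemma ellipticK_eq_ellipticF (k : ℝ) : ellipticK k = ellipticF k (Real.pi / 2) := rfl

lemma ellipticK_pos {k : ℝ} (hk : k ^ 2 < 1) : 0 < ellipticK k := by
  rw [ellipticK_eq_ellipticF, ← ellipticF_zero k]
  exact strictMono_ellipticF hk (by positivity)

lemma ellipticK_lt_ellipticK {k l : ℝ} (hk : 0 ≤ k) (hkl : k < l) (hl : l < 1) :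
    ellipticK k < ellipticK l := by
  have hl2 : l ^ 2 < 1 := by nlinarith
  have hk2 : k ^ 2 < l ^ 2 := by nlinarith
  have key : ∀ t, 0 < Real.sin t ^ 2 → ellipticIntegrand k t < ellipticIntegrand l t := by
    intro t ht
    have h := sq_mul_sin_sq_lt_one hl2 t
    unfold ellipticIntegrand
    refine one_div_lt_one_div_of_lt (Real.sqrt_pos.2 (by linarith)) ?_
    exact Real.sqrt_lt_sqrt (by linarith) (by nlinarith)
  refine intervalIntegral.integral_lt_integral_of_continuousOn_of_le_of_exists_lt
    (by positivity) (continuous_ellipticIntegrand (hk2.trans hl2)).continuousOn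
    (continuous_ellipticIntegrand hl2).continuousOn (fun t ht => ?_)
    ⟨Real.pi / 2, Set.right_mem_Icc.2 (by positivity), key _ (by simp)⟩
  rcases (sq_nonneg (Real.sin t)).eq_or_lt with h | h
  · simp [ellipticIntegrand, ← h]
  · exact (key t h).le

/-! ### The modulus one -/

lemma ellipticIntegrand_one (t : ℝ) : ellipticIntegrand 1 t = 1 / |Real.cos t| := by
  rw [ellipticIntegrand, ← Real.sqrt_sq_eq_abs, Real.cos_sq']
  simp

lemma continuousOn_ellipticIntegrand_one :
    ContinuousOn (ellipticIntegrand 1) (Set.Ioo (-(Real.pi / 2)) (Real.pi / 2)) := by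
  have h : ellipticIntegrand 1 = fun t => 1 / |Real.cos t| := funext ellipticIntegrand_one
  rw [h]
  refine continuousOn_const.div (by fun_prop) fun t ht => ?_
  exact (abs_pos.2 (Real.cos_pos_of_mem_Ioo ht).ne').ne'

lemma uIcc_zero_subset_Ioo {φ : ℝ} (hφ : φ ∈ Set.Ioo (-(Real.pi / 2)) (Real.pi / 2)) :
    Set.uIcc 0 φ ⊆ Set.Ioo (-(Real.pi / 2)) (Real.pi / 2) :=
  Set.ordConnected_Ioo.uIcc_subset ⟨by linarith [Real.pi_pos], by linarith [Real.pi_pos]⟩ hφ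

lemma intervalIntegrable_ellipticIntegrand_one {φ : ℝ}
    (hφ : φ ∈ Set.Ioo (-(Real.pi / 2)) (Real.pi / 2)) :
    IntervalIntegrable (ellipticIntegrand 1) volume 0 φ :=
  (continuousOn_ellipticIntegrand_one.mono (uIcc_zero_subset_Ioo hφ)).intervalIntegrable

lemma not_intervalIntegrable_ellipticIntegrand_one {φ c : ℝ} (hc : Real.cos c = 0)
    (hφ : c ∈ Set.uIcc 0 φ) (h0 : φ ≠ 0) :
    ¬ IntervalIntegrable (ellipticIntegrand 1) volume 0 φ := by
  refine not_intervalIntegrable_of_sub_inv_isBigO_punctured (c := c) ?_ h0.symm hφ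
  refine Asymptotics.IsBigO.of_bound 1 ?_
  have hs : -Real.sin c ≠ 0 := by
    intro h
    have := Real.sin_sq_add_cos_sq c
    rw [hc, neg_eq_zero.1 h] at this
    norm_num at this
  filter_upwards [(Real.hasDerivAt_cos c).eventually_ne (c := 0) hs] with x hx
  rw [ellipticIntegrand_one, norm_inv, Real.norm_eq_abs, Real.norm_eq_abs, one_mul, one_div,
    abs_inv, abs_abs]
  refine inv_anti₀ (abs_pos.2 hx) ?_
  have := Real.abs_cos_sub_cos_le x c
  rwa [hc, sub_zero] at this

/-- At `k = 1` the integrand is integrable only up to `|φ| < π/2`, so that the amplitude takes its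
values in `(-π/2, π/2)`. -/
lemma mem_Ioo_of_intervalIntegrable_one {φ : ℝ}
    (h : IntervalIntegrable (ellipticIntegrand 1) volume 0 φ) :
    φ ∈ Set.Ioo (-(Real.pi / 2)) (Real.pi / 2) := by
  have hπ := Real.pi_pos
  constructor
  · by_contra! hφ
    refine not_intervalIntegrable_ellipticIntegrand_one (c := -(Real.pi / 2)) (by simp)
      (Set.mem_uIcc.2 (Or.inr ⟨hφ, by linarith⟩)) (by linarith) h
  · by_contra! hφ
    refine not_intervalIntegrable_ellipticIntegrand_one (c := Real.pi / 2) (by simp)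
      (Set.mem_uIcc.2 (Or.inl ⟨by linarith, hφ⟩)) (by linarith) h

lemma ellipticF_one {φ : ℝ} (hφ : φ ∈ Set.Ioo (-(Real.pi / 2)) (Real.pi / 2)) :
    ellipticF 1 φ = Real.arsinh (Real.tan φ) := by
  have hd : ∀ t ∈ Set.uIcc 0 φ,
      HasDerivAt (fun t => Real.arsinh (Real.tan t)) (ellipticIntegrand 1 t) t := by
    intro t ht
    have hc := Real.cos_pos_of_mem_Ioo (uIcc_zero_subset_Ioo hφ ht)
    have := (Real.hasDerivAt_arsinh (Real.tan t)).comp t (Real.hasDerivAt_tan hc.ne')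
    refine this.congr_deriv ?_
    rw [ellipticIntegrand_one, abs_of_pos hc, ← Real.inv_sqrt_one_add_tan_sq hc]
    have h2 : 0 < √(1 + Real.tan t ^ 2) := Real.sqrt_pos.2 (by positivity)
    field_simp
  have := intervalIntegral.integral_eq_sub_of_hasDerivAt hd
    (intervalIntegrable_ellipticIntegrand_one hφ)
  simpa [ellipticF] using this

/-- At `k = 1` the amplitude is the Gudermannian function. -/
lemma jacobiAm_one (u : ℝ) : jacobiAm 1 u = Real.arctan (Real.sinh u) := by
  have hmem : Real.arctan (Real.sinh u) ∈ Set.Ioo (-(Real.pi / 2)) (Real.pi / 2) :=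
    ⟨Real.neg_pi_div_two_lt_arctan _, Real.arctan_lt_pi_div_two _⟩
  have hF : ellipticF 1 (Real.arctan (Real.sinh u)) = u := by
    rw [ellipticF_one hmem, Real.tan_arctan, Real.arsinh_sinh]
  have hspec := Classical.epsilon_spec (p := fun φ : ℝ =>
    IntervalIntegrable (ellipticIntegrand 1) volume 0 φ ∧
      (∫ t in (0 : ℝ)..φ, ellipticIntegrand 1 t) = u)
    ⟨_, intervalIntegrable_ellipticIntegrand_one hmem, hF⟩
  change IntervalIntegrable (ellipticIntegrand 1) volume 0 (jacobiAm 1 u) ∧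
    ellipticF 1 (jacobiAm 1 u) = u at hspec
  have hm := mem_Ioo_of_intervalIntegrable_one hspec.1
  have h2 := hspec.2
  rw [ellipticF_one hm] at h2
  rw [← congrArg Real.sinh h2, Real.sinh_arsinh, Real.arctan_tan hm.1 hm.2]

lemma sin_arctan_sinh (u : ℝ) : Real.sin (Real.arctan (Real.sinh u)) = Real.tanh u := by
  rw [Real.sin_arctan, add_comm, ← Real.cosh_sq, Real.sqrt_sq (Real.cosh_pos u).le,
    Real.tanh_eq_sinh_div_cosh]

lemma cos_arctan_sinh (u : ℝ) : Real.cos (Real.arctan (Real.sinh u)) = 1 / Real.cosh u := by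
  rw [Real.cos_arctan, add_comm, ← Real.cosh_sq, Real.sqrt_sq (Real.cosh_pos u).le]

lemma sqrt_one_sub_tanh_sq (u : ℝ) : √(1 - 1 ^ 2 * Real.tanh u ^ 2) = 1 / Real.cosh u := by
  have hc := Real.cosh_pos u
  rw [← Real.sqrt_sq (show 0 ≤ 1 / Real.cosh u by positivity)]
  congr 1
  rw [Real.tanh_eq_sinh_div_cosh]
  field_simp
  linarith [Real.cosh_sq u]

lemma jacobiSn_one (u : ℝ) : jacobiSn 1 u = Real.tanh u := by
  rw [jacobiSn, jacobiAm_one, sin_arctan_sinh]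

lemma jacobiCn_one (u : ℝ) : jacobiCn 1 u = 1 / Real.cosh u := by
  rw [jacobiCn, jacobiAm_one, cos_arctan_sinh]

lemma jacobiDn_one (u : ℝ) : jacobiDn 1 u = 1 / Real.cosh u := by
  rw [jacobiDn, jacobiSn_one, sqrt_one_sub_tanh_sq]

/-! ### The limit of the modulus to one -/

lemma eventually_sq_lt_one : ∀ᶠ k : ℝ in 𝓝[<] 1, k ^ 2 < 1 := by
  have h : ∀ᶠ k : ℝ in 𝓝[<] 1, -1 < k := 
    Filter.Eventually.filter_mono inf_le_left (Ioi_mem_nhds (by norm_num))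
  filter_upwards [self_mem_nhdsWithin, h] with k hk hk'
  have : k < 1 := hk
  nlinarith

lemma tendsto_ellipticF_one {φ : ℝ} (hφ : φ ∈ Set.Ioo (-(Real.pi / 2)) (Real.pi / 2)) :
    Tendsto (fun k => ellipticF k φ) (𝓝[<] 1) (𝓝 (ellipticF 1 φ)) := by
  refine intervalIntegral.tendsto_integral_filter_of_dominated_convergence
    (ellipticIntegrand 1) ?_ ?_ (intervalIntegrable_ellipticIntegrand_one hφ) ?_
  · filter_upwards [eventually_sq_lt_one] with k hk
    exact (continuous_ellipticIntegrand hk).aestronglyMeasurable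
  · filter_upwards [eventually_sq_lt_one] with k hk
    refine Eventually.of_forall fun t ht => ?_
    have hc := Real.cos_pos_of_mem_Ioo (uIcc_zero_subset_Ioo hφ (Set.uIoc_subset_uIcc ht))
    rw [Real.norm_of_nonneg (zero_le_one.trans (one_le_ellipticIntegrand hk t))]
    have hsc := Real.sin_sq_add_cos_sq t
    have hc2 : 0 < Real.cos t ^ 2 := by positivity
    refine one_div_le_one_div_of_le (Real.sqrt_pos.2 (by nlinarith)) (Real.sqrt_le_sqrt ?_)
    nlinarith [sq_nonneg (Real.sin t)]
  · refine Eventually.of_forall fun t ht => ?_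
    have hc := Real.cos_pos_of_mem_Ioo (uIcc_zero_subset_Ioo hφ (Set.uIoc_subset_uIcc ht))
    have hsc := Real.sin_sq_add_cos_sq t
    have hc2 : 0 < Real.cos t ^ 2 := by positivity
    have hcont : ContinuousAt (fun k => ellipticIntegrand k t) 1 := by
      unfold ellipticIntegrand
      refine continuousAt_const.div (by fun_prop) (Real.sqrt_pos.2 ?_).ne'
      nlinarith
    exact hcont.tendsto.mono_left inf_le_left

/-- Since `F(k, ·)` is increasing, the pointwise convergence `F(k, φ) → F(1, φ)` at both sides of
`am(u; 1)` traps `am(u; k)`. -/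
lemma tendsto_jacobiAm_one (u : ℝ) :
    Tendsto (fun k => jacobiAm k u) (𝓝[<] 1) (𝓝 (Real.arctan (Real.sinh u))) := by
  set γ := Real.arctan (Real.sinh u) with hγ
  have hmem : γ ∈ Set.Ioo (-(Real.pi / 2)) (Real.pi / 2) :=
    ⟨Real.neg_pi_div_two_lt_arctan _, Real.arctan_lt_pi_div_two _⟩
  have htan : Real.tan γ = Real.sinh u := Real.tan_arctan _
  rw [tendsto_order]
  constructor
  · intro a ha
    obtain ⟨b, hb1, hb2⟩ := exists_between (max_lt ha hmem.1)
    have hbm : b ∈ Set.Ioo (-(Real.pi / 2)) (Real.pi / 2) :=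
      ⟨(le_max_right _ _).trans_lt hb1, hb2.trans hmem.2⟩
    have hlt : ellipticF 1 b < u := by
      rw [ellipticF_one hbm, ← Real.arsinh_sinh u, ← htan]
      exact Real.arsinh_strictMono (Real.strictMonoOn_tan hbm hmem hb2)
    filter_upwards [eventually_sq_lt_one, (tendsto_ellipticF_one hbm).eventually_lt_const hlt]
      with k hk hkb
    rw [← ellipticF_jacobiAm hk u, (strictMono_ellipticF hk).lt_iff_lt] at hkb
    exact ((le_max_left _ _).trans_lt hb1).trans hkb
  · intro a ha
    obtain ⟨b, hb1, hb2⟩ := exists_between (lt_min ha hmem.2)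
    have hbm : b ∈ Set.Ioo (-(Real.pi / 2)) (Real.pi / 2) :=
      ⟨hmem.1.trans hb1, hb2.trans_le (min_le_right _ _)⟩
    have hlt : u < ellipticF 1 b := by
      rw [ellipticF_one hbm, ← Real.arsinh_sinh u, ← htan]
      exact Real.arsinh_strictMono (Real.strictMonoOn_tan hmem hbm hb1)
    filter_upwards [eventually_sq_lt_one, (tendsto_ellipticF_one hbm).eventually_const_lt hlt]
      with k hk hkb
    rw [← ellipticF_jacobiAm hk u, (strictMono_ellipticF hk).lt_iff_lt] at hkb
    exact hkb.trans (hb2.trans_le (min_le_left _ _))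

lemma tendsto_jacobiSn_one (u : ℝ) :
    Tendsto (fun k => jacobiSn k u) (𝓝[<] 1) (𝓝 (Real.tanh u)) := by
  rw [← sin_arctan_sinh]
  exact (Real.continuous_sin.tendsto _).comp (tendsto_jacobiAm_one u)

lemma tendsto_jacobiCn_one (u : ℝ) :
    Tendsto (fun k => jacobiCn k u) (𝓝[<] 1) (𝓝 (1 / Real.cosh u)) := by
  rw [← cos_arctan_sinh]
  exact (Real.continuous_cos.tendsto _).comp (tendsto_jacobiAm_one u)

lemma tendsto_jacobiDn_one (u : ℝ) :
    Tendsto (fun k => jacobiDn k u) (𝓝[<] 1) (𝓝 (1 / Real.cosh u)) := by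
  rw [← sqrt_one_sub_tanh_sq]
  have hk : Tendsto (fun k : ℝ => k) (𝓝[<] 1) (𝓝 1) := tendsto_id.mono_left inf_le_left
  exact (tendsto_const_nhds.sub ((hk.pow 2).mul ((tendsto_jacobiSn_one u).pow 2))).sqrt

/-! ### The polynomials at modulus one -/

/-- The product `∏_{j=1}^n tanh(wj)`, which plays the role of a factorial in the elliptic binomial
coefficients at `k = 1`. -/
noncomputable def tanhProd (w : ℝ) (n : ℕ) : ℝ :=
  ∏ j ∈ Finset.range n, Real.tanh (w * ((j : ℝ) + 1))

/-- The coefficient of `z^s`, `s ≤ n`, in the common value of the cn- and dn-polynomials at `k = 1`.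
Only the values with `s ≤ n` are meaningful. -/
noncomputable def limitCoeff (w : ℝ) (n s : ℕ) : ℝ :=
  (-1) ^ (n + s) / Real.cosh (w * ((n : ℝ) - s)) *
    (tanhProd w n / (tanhProd w s * tanhProd w (n - s)))

lemma tanh_pos_of_pos {x : ℝ} (hx : 0 < x) : 0 < Real.tanh x := by
  rw [Real.tanh_eq_sinh_div_cosh]
  exact div_pos (Real.sinh_pos_iff.2 hx) (Real.cosh_pos x)

lemma tanhProd_pos {w : ℝ} (hw : 0 < w) (n : ℕ) : 0 < tanhProd w n :=
  Finset.prod_pos fun _ _ => tanh_pos_of_pos (by positivity)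

lemma tanhProd_succ (w : ℝ) (n : ℕ) :
    tanhProd w (n + 1) = tanhProd w n * Real.tanh (w * ((n : ℝ) + 1)) :=
  Finset.prod_range_succ _ _

@[simp] lemma tanhProd_zero (w : ℝ) : tanhProd w 0 = 1 := rfl

lemma prod_tanh_div_tanh {w : ℝ} (hw : 0 < w) (j r : ℕ) :
    ∏ s ∈ Finset.range j,
      Real.tanh (w * (((j + r : ℕ) : ℝ) - (s : ℝ))) / Real.tanh (w * ((s : ℝ) + 1)) =
      tanhProd w (j + r) / (tanhProd w j * tanhProd w r) := by
  have h := fun n => (tanhProd_pos hw n).ne'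
  induction j generalizing r with
  | zero => simp [h]
  | succ j ih =>
    have hj : Real.tanh (w * ((j : ℝ) + 1)) ≠ 0 := (tanh_pos_of_pos (by positivity)).ne'
    have e : j + 1 + r = j + (r + 1) := by ring
    rw [Finset.prod_range_succ, e, ih (r + 1), tanhProd_succ w r, tanhProd_succ w j]
    have e2 : w * (((j + (r + 1) : ℕ) : ℝ) - j) = w * ((r : ℝ) + 1) := by push_cast; ring
    have hr : Real.tanh (w * ((r : ℝ) + 1)) ≠ 0 := (tanh_pos_of_pos (by positivity)).ne'
    rw [e2]
    have := h j
    have := h r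
    field_simp

lemma ellipticBinom_one {w : ℝ} (hw : 0 < w) {n s : ℕ} (hs : s ≤ n) :
    ellipticBinom 1 w n s = tanhProd w n / (tanhProd w s * tanhProd w (n - s)) := by
  obtain ⟨r, rfl⟩ := Nat.exists_eq_add_of_le hs
  rw [ellipticBinom, if_pos hs, Nat.add_sub_cancel_left, ← prod_tanh_div_tanh hw]
  simp only [jacobiSn_one]

lemma coeff_sum_range_monomial (a : ℕ → ℝ) (n s : ℕ) :
    (∑ i ∈ Finset.range (n + 1), Polynomial.monomial i (a i)).coeff s = if s ≤ n then a s else 0 := by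
  simp [Polynomial.finsetSum_coeff, Polynomial.coeff_monomial]

lemma cnPoly_one {w : ℝ} (hw : 0 < w) (n : ℕ) :
    cnPoly 1 w n = ∑ s ∈ Finset.range (n + 1), Polynomial.monomial s (limitCoeff w n s) := by
  refine Finset.sum_congr rfl fun s hs => ?_
  have hs' : s ≤ n := by simpa [Nat.lt_succ_iff] using hs
  rw [ellipticBinom_one hw hs', jacobiDn_one, jacobiCn_one, limitCoeff]
  split_ifs with h
  · rw [pow_add _ n s, h.neg_one_pow]; congr 1; ring
  · rw [pow_add _ n s, (Nat.not_even_iff_odd.1 h).neg_one_pow]; congr 1; ring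

lemma dnPoly_one (w : ℝ) (n : ℕ) : dnPoly 1 w n = cnPoly 1 w n := by
  simp only [dnPoly, cnPoly, jacobiDn_one, jacobiCn_one]

lemma coeff_cnPoly_one {w : ℝ} (hw : 0 < w) {n s : ℕ} (hs : s ≤ n) :
    (cnPoly 1 w n).coeff s = limitCoeff w n s := by
  rw [cnPoly_one hw, coeff_sum_range_monomial, if_pos hs]

lemma tendsto_ellipticBinom {w : ℝ} (hw : 0 < w) (n s : ℕ) :
    Tendsto (fun k => ellipticBinom k w n s) (𝓝[<] 1) (𝓝 (ellipticBinom 1 w n s)) := by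
  unfold ellipticBinom
  split_ifs with h
  · refine tendsto_finsetProd _ fun i _ => ?_
    rw [jacobiSn_one, jacobiSn_one]
    exact (tendsto_jacobiSn_one _).div (tendsto_jacobiSn_one _)
      (tanh_pos_of_pos (by positivity)).ne'
  · exact tendsto_const_nhds

lemma tendsto_coeff_cnPoly {w : ℝ} (hw : 0 < w) (n s : ℕ) :
    Tendsto (fun k => (cnPoly k w n).coeff s) (𝓝[<] 1) (𝓝 ((cnPoly 1 w n).coeff s)) := by
  simp only [cnPoly, coeff_sum_range_monomial]
  split_ifs
  · rw [jacobiDn_one]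
    exact ((tendsto_jacobiDn_one _).const_mul _).mul (tendsto_ellipticBinom hw n s)
  · rw [jacobiCn_one]
    exact ((tendsto_jacobiCn_one _).const_mul _).mul (tendsto_ellipticBinom hw n s)
  · exact tendsto_const_nhds

lemma tendsto_coeff_dnPoly {w : ℝ} (hw : 0 < w) (n s : ℕ) :
    Tendsto (fun k => (dnPoly k w n).coeff s) (𝓝[<] 1) (𝓝 ((cnPoly 1 w n).coeff s)) := by
  rw [← dnPoly_one]
  simp only [dnPoly, coeff_sum_range_monomial]
  split_ifs
  · rw [jacobiCn_one]
    exact ((tendsto_jacobiCn_one _).const_mul _).mul (tendsto_ellipticBinom hw n s)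
  · rw [jacobiDn_one]
    exact ((tendsto_jacobiDn_one _).const_mul _).mul (tendsto_ellipticBinom hw n s)
  · exact tendsto_const_nhds

lemma limitCoeff_self {w : ℝ} (hw : 0 < w) (n : ℕ) : limitCoeff w n n = 1 := by
  have := (tanhProd_pos hw n).ne'
  simp [limitCoeff, ← two_mul, this]

lemma limitCoeff_zero {w : ℝ} (hw : 0 < w) (n : ℕ) :
    limitCoeff w n 0 = (-1) ^ n / Real.cosh (w * n) := by
  have := (tanhProd_pos hw n).ne'
  simp [limitCoeff, this]

lemma natDegree_cnPoly_one_le {w : ℝ} (hw : 0 < w) (n : ℕ) : (cnPoly 1 w n).natDegree ≤ n := by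
  rw [cnPoly_one hw]
  refine Polynomial.natDegree_sum_le_of_forall_le _ _ fun s hs => ?_
  exact (Polynomial.natDegree_monomial_le _).trans (by simpa [Nat.lt_succ_iff] using hs)

lemma monic_cnPoly_one {w : ℝ} (hw : 0 < w) (n : ℕ) : (cnPoly 1 w n).Monic :=
  Polynomial.monic_of_natDegree_le_of_coeff_eq_one n (natDegree_cnPoly_one_le hw n)
    (by rw [coeff_cnPoly_one hw le_rfl, limitCoeff_self hw])

lemma natDegree_cnPoly_one {w : ℝ} (hw : 0 < w) (n : ℕ) : (cnPoly 1 w n).natDegree = n :=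
  Polynomial.natDegree_eq_of_le_of_coeff_ne_zero (natDegree_cnPoly_one_le hw n)
    (by rw [coeff_cnPoly_one hw le_rfl, limitCoeff_self hw]; exact one_ne_zero)

/-! ### Orthogonality with respect to the moments `1 / cosh(wm)` -/

/-- The recurrence `Φ_{n+1}(z) = z Φ_n(z) - a_n z^n Φ_n(1/z)`, with
`a_n = (-1)^n / cosh(w(n+1))`, for the middle coefficients. -/
lemma limitCoeff_succ_succ {w : ℝ} (hw : 0 < w) {n s : ℕ} (hs : s < n) :
    limitCoeff w (n + 1) (s + 1) = limitCoeff w n s -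
      (-1) ^ n / Real.cosh (w * ((n : ℝ) + 1)) * limitCoeff w n (n - 1 - s) := by
  obtain ⟨r, rfl⟩ := Nat.exists_eq_add_of_lt hs
  have e1 : s + r + 1 - 1 - s = r := by omega
  have e2 : s + r + 1 + 1 - (s + 1) = r + 1 := by omega
  have e3 : s + r + 1 - s = r + 1 := by omega
  have e4 : s + r + 1 - r = s + 1 := by omega
  simp only [limitCoeff, e1, e2, e3, e4, tanhProd_succ w (s + r + 1), tanhProd_succ w s,
    tanhProd_succ w r]
  have c1 : w * (((s + r + 1 + 1 : ℕ) : ℝ) - ((s + 1 : ℕ) : ℝ)) = w * ((r : ℝ) + 1) := by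
    push_cast; ring
  have c2 : w * (((s + r + 1 : ℕ) : ℝ) - (s : ℝ)) = w * ((r : ℝ) + 1) := by push_cast; ring
  have c3 : w * (((s + r + 1 : ℕ) : ℝ) - (r : ℝ)) = w * ((s : ℝ) + 1) := by push_cast; ring
  have c4 : w * (((s + r + 1 : ℕ) : ℝ) + 1) = w * ((s : ℝ) + 1) + w * ((r : ℝ) + 1) := by
    push_cast; ring
  have p1 : (-1 : ℝ) ^ (s + r + 1 + 1 + (s + 1)) = (-1) ^ (s + r + 1 + s) := by
    rw [show s + r + 1 + 1 + (s + 1) = s + r + 1 + s + 2 by ring, pow_add]; norm_num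
  have p2 : (-1 : ℝ) ^ (s + r + 1) * (-1) ^ (s + r + 1 + r) = -(-1) ^ (s + r + 1 + s) := by
    rw [← pow_add, show s + r + 1 + (s + r + 1 + r) = s + r + 1 + s + 2 * r + 1 by ring, pow_add,
      pow_add _ _ (2 * r), pow_mul]
    norm_num
  rw [c1, c2, c3, c4, p1]
  have hS : 0 < Real.sinh (w * ((s : ℝ) + 1)) := Real.sinh_pos_iff.2 (by positivity)
  have hR : 0 < Real.sinh (w * ((r : ℝ) + 1)) := Real.sinh_pos_iff.2 (by positivity)
  have hcS := Real.cosh_pos (w * ((s : ℝ) + 1))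
  have hcR := Real.cosh_pos (w * ((r : ℝ) + 1))
  have hcA : 0 < Real.cosh (w * ((s : ℝ) + 1) + w * ((r : ℝ) + 1)) := Real.cosh_pos _
  have hT := fun n => tanhProd_pos hw n
  have t1 := hT s
  have t2 := hT r
  have t3 := hT (s + r + 1)
  have hadd := Real.cosh_add (w * ((s : ℝ) + 1)) (w * ((r : ℝ) + 1))
  have hsadd := Real.sinh_add (w * ((s : ℝ) + 1)) (w * ((r : ℝ) + 1))
  have hsq := Real.cosh_sq (w * ((s : ℝ) + 1))
  simp only [Real.tanh_eq_sinh_div_cosh]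
  set S := Real.sinh (w * ((s : ℝ) + 1))
  set R := Real.sinh (w * ((r : ℝ) + 1))
  set CS := Real.cosh (w * ((s : ℝ) + 1))
  set CR := Real.cosh (w * ((r : ℝ) + 1))
  set CA := Real.cosh (w * ((s : ℝ) + 1) + w * ((r : ℝ) + 1))
  set SA := Real.sinh (w * ((s : ℝ) + 1) + w * ((r : ℝ) + 1))
  -- The recurrence is the subtraction formula for `tanh`.
  have key : SA * CS - CA * S = R := by rw [hsadd, hadd]; linear_combination R * hsq
  have lhs : (-1 : ℝ) ^ (s + r + 1 + s) / CR *
      (tanhProd w (s + r + 1) * (SA / CA) / (tanhProd w s * (S / CS) * (tanhProd w r * (R / CR))))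
      = (-1) ^ (s + r + 1 + s) * (tanhProd w (s + r + 1) / (tanhProd w s * tanhProd w r)) *
        (SA * CS / (CA * S * R)) := by field_simp
  have rhs1 : (-1 : ℝ) ^ (s + r + 1 + s) / CR *
      (tanhProd w (s + r + 1) / (tanhProd w s * (tanhProd w r * (R / CR))))
      = (-1) ^ (s + r + 1 + s) * (tanhProd w (s + r + 1) / (tanhProd w s * tanhProd w r)) *
        (1 / R) := by field_simp
  have rhs2 : (-1 : ℝ) ^ (s + r + 1) / CA * ((-1) ^ (s + r + 1 + r) / CS *
      (tanhProd w (s + r + 1) / (tanhProd w r * (tanhProd w s * (S / CS)))))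
      = ((-1) ^ (s + r + 1) * (-1) ^ (s + r + 1 + r)) *
        (tanhProd w (s + r + 1) / (tanhProd w s * tanhProd w r)) * (1 / (CA * S)) := by field_simp
  rw [lhs, rhs1, rhs2, p2]
  have : SA * CS / (CA * S * R) = 1 / R + 1 / (CA * S) := by
    field_simp; linarith
  rw [this]; ring

/-- The generating sum `∑_s W_{ns} / cosh(ws - y)` factors completely, which exhibits its zeros
`y = 0, w, …, (n-1)w`; at `y = wj` it is `L{Φ_n(z) z^{-j}}`. -/
lemma sum_limitCoeff_div_cosh {w : ℝ} (hw : 0 < w) (n : ℕ) (y : ℝ) :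
    ∑ s ∈ Finset.range (n + 1), limitCoeff w n s * (1 / Real.cosh (w * s - y)) =
      tanhProd w n * (∏ l ∈ Finset.range n, Real.sinh (y - w * l)) /
        ∏ s ∈ Finset.range (n + 1), Real.cosh (y - w * s) := by
  induction n generalizing y with
  | zero => simp [limitCoeff]
  | succ n ih =>
    set a : ℝ := (-1) ^ n / Real.cosh (w * ((n : ℝ) + 1)) with ha
    -- Reduction to level `n` by the recurrence.
    have hrec : ∑ s ∈ Finset.range (n + 1 + 1),
        limitCoeff w (n + 1) s * (1 / Real.cosh (w * s - y)) =
        ∑ s ∈ Finset.range (n + 1), limitCoeff w n s * (1 / Real.cosh (w * s - (y - w))) -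
        a * ∑ s ∈ Finset.range (n + 1), limitCoeff w n s * (1 / Real.cosh (w * s - (w * n - y))) := by
      have hrefl : ∑ s ∈ Finset.range (n + 1),
          limitCoeff w n s * (1 / Real.cosh (w * s - (w * n - y))) =
          ∑ s ∈ Finset.range (n + 1), limitCoeff w n (n - s) * (1 / Real.cosh (w * s - y)) := by
        rw [← Finset.sum_range_reflect]
        refine Finset.sum_congr rfl fun s hs => ?_
        have hs' : s ≤ n := by simpa [Nat.lt_succ_iff] using hs
        have e : n + 1 - 1 - s = n - s := by omega
        rw [e, Nat.cast_sub hs', ← Real.cosh_neg (w * s - y)]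
        congr 3; ring
      rw [hrefl, Finset.sum_range_succ', Finset.sum_range_succ, Finset.sum_range_succ _ n,
        Finset.sum_range_succ' _ n, limitCoeff_self hw, limitCoeff_zero hw, Nat.sub_zero,
        limitCoeff_self hw]
      have hmid : ∑ s ∈ Finset.range n,
          limitCoeff w (n + 1) (s + 1) * (1 / Real.cosh (w * ((s + 1 : ℕ) : ℝ) - y)) =
          ∑ s ∈ Finset.range n, limitCoeff w n s * (1 / Real.cosh (w * s - (y - w))) -
          a * ∑ s ∈ Finset.range n,
            limitCoeff w n (n - (s + 1)) * (1 / Real.cosh (w * ((s + 1 : ℕ) : ℝ) - y)) := by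
        rw [Finset.mul_sum, ← Finset.sum_sub_distrib]
        refine Finset.sum_congr rfl fun s hs => ?_
        rw [limitCoeff_succ_succ hw (Finset.mem_range.1 hs),
          show n - 1 - s = n - (s + 1) by omega,
          show w * ((s + 1 : ℕ) : ℝ) - y = w * s - (y - w) by push_cast; ring]
        ring
      rw [hmid, ha, show w * ((n + 1 : ℕ) : ℝ) - y = w * n - (y - w) by
        push_cast; ring]
      push_cast
      rw [pow_succ]
      ring
    rw [hrec, ih, ih]
    have h1 : ∏ l ∈ Finset.range n, Real.sinh (y - w - w * l) =
        ∏ l ∈ Finset.range n, Real.sinh (y - w * ((l + 1 : ℕ) : ℝ)) :=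
      Finset.prod_congr rfl fun l _ => by congr 1; push_cast; ring
    have h2 : ∏ l ∈ Finset.range (n + 1), Real.cosh (y - w - w * l) =
        ∏ l ∈ Finset.range (n + 1), Real.cosh (y - w * ((l + 1 : ℕ) : ℝ)) :=
      Finset.prod_congr rfl fun l _ => by congr 1; push_cast; ring
    have h3 : ∏ l ∈ Finset.range n, Real.sinh (w * n - y - w * l) =
        (-1) ^ n * ∏ l ∈ Finset.range n, Real.sinh (y - w * ((l + 1 : ℕ) : ℝ)) := by
      rw [← Finset.prod_range_reflect]
      conv_rhs => rw [← Finset.card_range n, ← Finset.prod_const, Finset.card_range,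
        ← Finset.prod_mul_distrib]
      refine Finset.prod_congr rfl fun l hl => ?_
      have hl' : l < n := Finset.mem_range.1 hl
      rw [neg_one_mul, ← Real.sinh_neg]
      congr 1
      rw [show n - 1 - l = n - (l + 1) by omega, Nat.cast_sub hl']
      push_cast; ring
    have h4 : ∏ l ∈ Finset.range (n + 1), Real.cosh (w * n - y - w * l) =
        ∏ l ∈ Finset.range (n + 1), Real.cosh (y - w * l) := by
      rw [← Finset.prod_range_reflect]
      refine Finset.prod_congr rfl fun l hl => ?_
      have hl' : l ≤ n := by simpa [Nat.lt_succ_iff] using hl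
      rw [show n + 1 - 1 - l = n - l by omega, Nat.cast_sub hl', ← Real.cosh_neg]
      congr 1; ring
    have hC : ∀ m, 0 < ∏ l ∈ Finset.range m, Real.cosh (y - w * l) := fun m =>
      Finset.prod_pos fun _ _ => Real.cosh_pos _
    have hC' : 0 < ∏ l ∈ Finset.range (n + 1), Real.cosh (y - w * ((l + 1 : ℕ) : ℝ)) :=
      Finset.prod_pos fun _ _ => Real.cosh_pos _
    have e1 := Finset.prod_range_succ (fun l : ℕ => Real.cosh (y - w * l)) (n + 1)
    have e2 := Finset.prod_range_succ' (fun l : ℕ => Real.cosh (y - w * l)) (n + 1)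
    have e3 := Finset.prod_range_succ' (fun l : ℕ => Real.sinh (y - w * l)) n
    simp only [Nat.cast_zero, mul_zero, sub_zero] at e2 e3
    rw [h1, h2, h3, h4, e3, tanhProd_succ]
    set P := ∏ l ∈ Finset.range n, Real.sinh (y - w * ((l + 1 : ℕ) : ℝ))
    have hD := hC (n + 2)
    have hD1 := hC (n + 1)
    set D := ∏ l ∈ Finset.range (n + 2), Real.cosh (y - w * l)
    set D1 := ∏ l ∈ Finset.range (n + 1), Real.cosh (y - w * l)
    set D2 := ∏ l ∈ Finset.range (n + 1), Real.cosh (y - w * ((l + 1 : ℕ) : ℝ))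
    change D = _ at e1 e2
    change _ = tanhProd w n * Real.tanh (w * ((n : ℝ) + 1)) * (P * Real.sinh y) / D
    have hq1 : 1 / D1 = Real.cosh (y - w * ((n + 1 : ℕ) : ℝ)) / D := by
      rw [e1]; have := Real.cosh_pos (y - w * ((n + 1 : ℕ) : ℝ)); field_simp
    have hq2 : 1 / D2 = Real.cosh y / D := by
      rw [e2]; have := Real.cosh_pos y; field_simp
    have hpow : ((-1 : ℝ) ^ n) * (-1) ^ n = 1 := by rw [← mul_pow]; norm_num
    calc tanhProd w n * P / D2 - a * (tanhProd w n * ((-1) ^ n * P) / D1)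
        = tanhProd w n * P * (1 / D2) - a * (-1) ^ n * (tanhProd w n * P) * (1 / D1) := by ring
      _ = tanhProd w n * P * (Real.cosh y / D) -
          ((-1) ^ n * (-1) ^ n) / Real.cosh (w * ((n : ℝ) + 1)) * (tanhProd w n * P) *
            (Real.cosh (y - w * ((n : ℝ) + 1)) / D) := by rw [hq1, hq2, ha]; push_cast; ring
      _ = _ := by
        rw [hpow, Real.cosh_sub, Real.tanh_eq_sinh_div_cosh]
        have := Real.cosh_pos (w * ((n : ℝ) + 1))
        field_simp
        ring

lemma momentFunctional_cnPoly_one {w : ℝ} (hw : 0 < w) (c : ℤ → ℝ) (n j : ℕ) :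
    momentFunctional c (cnPoly 1 w n) j =
      ∑ s ∈ Finset.range (n + 1), limitCoeff w n s * c ((s : ℤ) - j) := by
  rw [momentFunctional, Polynomial.sum_over_range' _ (by simp) (n + 1)
    (by rw [natDegree_cnPoly_one hw]; omega)]
  refine Finset.sum_congr rfl fun s hs => ?_
  rw [coeff_cnPoly_one hw (by simpa [Nat.lt_succ_iff] using hs)]

lemma momentFunctional_sech {w : ℝ} (hw : 0 < w) {c : ℤ → ℝ}
    (hc : ∀ m : ℤ, c m = 1 / Real.cosh (w * m)) (n j : ℕ) :
    momentFunctional c (cnPoly 1 w n) j =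
      tanhProd w n * (∏ l ∈ Finset.range n, Real.sinh (w * j - w * l)) /
        ∏ s ∈ Finset.range (n + 1), Real.cosh (w * j - w * s) := by
  rw [momentFunctional_cnPoly_one hw, ← sum_limitCoeff_div_cosh hw]
  refine Finset.sum_congr rfl fun s _ => ?_
  rw [hc]; push_cast; rw [mul_sub]

lemma momentFunctional_sech_of_lt {w : ℝ} (hw : 0 < w) {c : ℤ → ℝ}
    (hc : ∀ m : ℤ, c m = 1 / Real.cosh (w * m)) {n j : ℕ} (hj : j < n) :
    momentFunctional c (cnPoly 1 w n) j = 0 := by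
  rw [momentFunctional_sech hw hc, Finset.prod_eq_zero (Finset.mem_range.2 hj) (by simp)]
  simp

lemma momentFunctional_sech_self {w : ℝ} (hw : 0 < w) {c : ℤ → ℝ}
    (hc : ∀ m : ℤ, c m = 1 / Real.cosh (w * m)) (n : ℕ) :
    momentFunctional c (cnPoly 1 w n) n = tanhProd w n ^ 2 := by
  rw [momentFunctional_sech hw hc, Finset.prod_range_succ, sub_self, Real.cosh_zero, mul_one,
    mul_div_assoc, ← Finset.prod_div_distrib, sq]
  congr 1
  rw [tanhProd, ← Finset.prod_range_reflect]
  refine Finset.prod_congr rfl fun l hl => ?_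
  rw [show n - 1 - l = n - (l + 1) by omega, Nat.cast_sub (Finset.mem_range.1 hl),
    ← Real.tanh_eq_sinh_div_cosh]
  congr 1; push_cast; ring

/-- Because the polynomials are monic, the conditions `L{Φ_n} = 0`, `n ≥ 1`, determine the moments
`c_n` one after the other. -/
lemma isMomentSequence_cnPoly_one_iff {w : ℝ} (hw : 0 < w) (c : ℤ → ℝ) :
    IsMomentSequence (cnPoly 1 w) c ↔ ∀ m : ℤ, c m = 1 / Real.cosh (w * m) := by
  constructor
  · rintro ⟨h0, hsymm, horth⟩
    set d : ℤ → ℝ := fun m => 1 / Real.cosh (w * m) with hd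
    have hnat : ∀ n : ℕ, c n = d n := by
      intro n
      induction n using Nat.strong_induction_on with
      | _ n ih =>
        rcases Nat.eq_zero_or_pos n with rfl | hn
        · simp [h0, hd]
        have h1 := (horth n).1 0 hn
        have h2 := momentFunctional_sech_of_lt hw (c := d) (fun _ => rfl) hn
        rw [momentFunctional_cnPoly_one hw, Finset.sum_range_succ, limitCoeff_self hw] at h1 h2
        have h3 : ∑ s ∈ Finset.range n, limitCoeff w n s * c ((s : ℤ) - (0 : ℕ)) =
            ∑ s ∈ Finset.range n, limitCoeff w n s * d ((s : ℤ) - (0 : ℕ)) :=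
          Finset.sum_congr rfl fun s hs => by
            rw [Nat.cast_zero, sub_zero, ih s (Finset.mem_range.1 hs)]
        rw [h3] at h1
        simp only [Nat.cast_zero, sub_zero] at h1 h2
        linarith
    intro m
    rcases Int.natAbs_eq m with h | h
    · rw [h]; exact hnat _
    · rw [h, hsymm, hnat]
      simp only [hd]
      push_cast
      rw [mul_neg, Real.cosh_neg]
  · intro hc
    refine ⟨by simp [hc], fun m => ?_, fun n => ⟨fun j hj => ?_, ?_⟩⟩
    · rw [hc, hc]; push_cast; rw [mul_neg, Real.cosh_neg]
    · exact momentFunctional_sech_of_lt hw hc hj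
    · rw [momentFunctional_sech_self hw hc]
      exact (pow_pos (tanhProd_pos hw n) 2).ne'

/-! ### The basic hypergeometric form -/

lemma limitCoeff_succ {w : ℝ} (hw : 0 < w) (s r : ℕ) :
    limitCoeff w (s + 1 + r) (s + 1) = limitCoeff w (s + 1 + r) s *
      (-(Real.sinh (w * ((r : ℝ) + 1)) /
        (Real.cosh (w * r) * Real.tanh (w * ((s : ℝ) + 1))))) := by
  have hT := fun n => tanhProd_pos hw n
  have t1 := hT s
  have t2 := hT r
  have hts : 0 < Real.tanh (w * ((s : ℝ) + 1)) := tanh_pos_of_pos (by positivity)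
  have hsr : 0 < Real.sinh (w * ((r : ℝ) + 1)) := Real.sinh_pos_iff.2 (by positivity)
  have hcr := Real.cosh_pos (w * r)
  have hcr1 := Real.cosh_pos (w * ((r : ℝ) + 1))
  have c1 : w * (((s + 1 + r : ℕ) : ℝ) - ((s + 1 : ℕ) : ℝ)) = w * r := by push_cast; ring
  have c2 : w * (((s + 1 + r : ℕ) : ℝ) - (s : ℝ)) = w * ((r : ℝ) + 1) := by push_cast; ring
  rw [limitCoeff, limitCoeff, show s + 1 + r - (s + 1) = r by omega,
    show s + 1 + r - s = r + 1 by omega, tanhProd_succ w s, tanhProd_succ w r, c1, c2,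
    Real.tanh_eq_sinh_div_cosh (w * ((r : ℝ) + 1)), ← add_assoc, pow_succ (-1 : ℝ)]
  field_simp

/-- The ratio of consecutive coefficients, rewritten in terms of `q = e^{-2w}`. -/
lemma sinh_div_cosh_mul_tanh_eq {w : ℝ} (hw : 0 < w) (n s r : ℕ) (hn : n = s + 1 + r) :
    -(Real.sinh (w * ((r : ℝ) + 1)) / (Real.cosh (w * r) * Real.tanh (w * ((s : ℝ) + 1)))) =
      (1 - (Real.exp (-w) ^ 2) ^ (-(n : ℤ)) * (Real.exp (-w) ^ 2) ^ s) *
        (1 - -(Real.exp (-w) ^ 2) * (Real.exp (-w) ^ 2) ^ s) /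
      ((1 - Real.exp (-w) ^ 2 * (Real.exp (-w) ^ 2) ^ s) *
        (1 - -(Real.exp (-w) ^ 2) ^ (1 - (n : ℤ)) * (Real.exp (-w) ^ 2) ^ s)) * Real.exp (-w) := by
  set x := Real.exp (-w) with hx
  have hx0 : 0 < x := Real.exp_pos _
  have hx1 : x < 1 := by rw [hx]; simpa using hw
  have hexp : ∀ m : ℕ, Real.exp (-(w * m)) = x ^ m := fun m => by
    rw [hx, ← Real.exp_nat_mul]; congr 1; ring
  have hexp' : ∀ m : ℕ, Real.exp (w * m) = (x ^ m)⁻¹ := fun m => by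
    rw [← hexp, ← Real.exp_neg, neg_neg]
  have hr1 : w * ((r : ℝ) + 1) = w * ((r + 1 : ℕ) : ℝ) := by push_cast; ring
  have hs1 : w * ((s : ℝ) + 1) = w * ((s + 1 : ℕ) : ℝ) := by push_cast; ring
  have z1 : (x ^ 2) ^ (-(n : ℤ)) = ((x ^ s) ^ 2 * x ^ 2 * (x ^ r) ^ 2)⁻¹ := by
    rw [zpow_neg, zpow_natCast, hn]; congr 1; ring
  have z2 : (x ^ 2) ^ (1 - (n : ℤ)) = ((x ^ s) ^ 2 * (x ^ r) ^ 2)⁻¹ := by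
    rw [show 1 - (n : ℤ) = -((s + r : ℕ) : ℤ) by rw [hn]; push_cast; ring, zpow_neg, zpow_natCast]
    congr 1; ring
  have z3 : (x ^ 2) ^ s = (x ^ s) ^ 2 := by ring
  rw [z1, z2, z3, hr1, hs1, Real.tanh_eq, Real.sinh_eq, Real.cosh_eq, hexp, hexp, hexp, hexp',
    hexp', hexp', pow_succ x r, pow_succ x s]
  have hS1 : (x ^ s) ^ 2 * x ^ 2 < 1 := by
    rw [← mul_pow, ← pow_succ]
    exact pow_lt_one₀ (by positivity) (pow_lt_one₀ hx0.le hx1 (by omega)) (by norm_num)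
  have hS : 0 < x ^ s := by positivity
  have hR : 0 < x ^ r := by positivity
  set S := x ^ s
  set R := x ^ r
  have d1 : 1 - x ^ 2 * S ^ 2 ≠ 0 := by nlinarith
  have d2 : 1 - -(S ^ 2 * R ^ 2)⁻¹ * S ^ 2 = (1 + R ^ 2) / R ^ 2 := by field_simp; ring
  have d3 : 1 - (S ^ 2 * x ^ 2 * R ^ 2)⁻¹ * S ^ 2 = (x ^ 2 * R ^ 2 - 1) / (x ^ 2 * R ^ 2) := by
    field_simp
  have d4 : ((S * x)⁻¹ - S * x) / ((S * x)⁻¹ + S * x) =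
      (1 - x ^ 2 * S ^ 2) / (1 + x ^ 2 * S ^ 2) := by field_simp
  have d5 : ((R * x)⁻¹ - R * x) / 2 = (1 - x ^ 2 * R ^ 2) / (2 * (x * R)) := by field_simp
  have d6 : (R⁻¹ + R) / 2 = (1 + R ^ 2) / (2 * R) := by field_simp
  rw [d2, d3, d4, d5, d6]
  field_simp
  ring

lemma limitCoeff_eq_prod {w : ℝ} (hw : 0 < w) (n s : ℕ) (hs : s ≤ n) :
    limitCoeff w n s = (-1) ^ n / Real.cosh (w * n) *
      ((∏ i ∈ Finset.range s,
        ((1 - (Real.exp (-w) ^ 2) ^ (-(n : ℤ)) * (Real.exp (-w) ^ 2) ^ i) *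
          (1 - -(Real.exp (-w) ^ 2) * (Real.exp (-w) ^ 2) ^ i) /
        ((1 - Real.exp (-w) ^ 2 * (Real.exp (-w) ^ 2) ^ i) *
          (1 - -(Real.exp (-w) ^ 2) ^ (1 - (n : ℤ)) * (Real.exp (-w) ^ 2) ^ i)))) *
        Real.exp (-w) ^ s) := by
  induction s with
  | zero => simp [limitCoeff_zero hw]
  | succ s ih =>
    obtain ⟨r, rfl⟩ := Nat.exists_eq_add_of_le hs
    rw [limitCoeff_succ hw, sinh_div_cosh_mul_tanh_eq hw _ s r rfl, ih (by omega),
      Finset.prod_range_succ, pow_succ (Real.exp (-w)) s]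
    ring

lemma aeval_cnPoly_one {w : ℝ} (hw : 0 < w) (n : ℕ) (z : ℂ) :
    Polynomial.aeval z (cnPoly 1 w n) =
      ∑ s ∈ Finset.range (n + 1), (limitCoeff w n s : ℂ) * z ^ s := by
  rw [cnPoly_one hw, map_sum]
  refine Finset.sum_congr rfl fun s _ => ?_
  rw [Polynomial.aeval_monomial]
  rfl

lemma aeval_cnPoly_one_eq_basicHypergeom21 {w : ℝ} (hw : 0 < w) {q : ℝ}
    (hq : q = Real.exp (-2 * w)) (n : ℕ) (z : ℂ) :
    Polynomial.aeval z (cnPoly 1 w n) =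
      2 * (-1 : ℂ) ^ n * ((q ^ (-(n : ℝ) / 2) : ℝ) : ℂ) / (1 + (q : ℂ) ^ (-(n : ℤ))) *
        basicHypergeom21 q ((q : ℂ) ^ (-(n : ℤ))) (-(q : ℂ)) (-(q : ℂ) ^ (1 - (n : ℤ)))
          (z * ((q ^ (1 / 2 : ℝ) : ℝ) : ℂ)) := by
  set x := Real.exp (-w) with hx
  have hx0 : 0 < x := Real.exp_pos _
  have hqx : q = x ^ 2 := by rw [hq, hx, ← Real.exp_nat_mul]; congr 1; push_cast; ring
  have hhalf : q ^ (1 / 2 : ℝ) = x := by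
    rw [hqx, ← Real.sqrt_eq_rpow, Real.sqrt_sq hx0.le]
  have hpow : q ^ (-(n : ℝ) / 2) = (x ^ n)⁻¹ := by
    rw [hqx, ← Real.rpow_natCast x 2, ← Real.rpow_mul hx0.le, ← Real.rpow_natCast x n,
      ← Real.rpow_neg hx0.le]
    congr 1; push_cast; ring
  have hpre : 2 * (-1 : ℝ) ^ n * (x ^ n)⁻¹ / (1 + q ^ (-(n : ℤ))) =
      (-1) ^ n / Real.cosh (w * n) := by
    have e1 : Real.exp (-(w * n)) = x ^ n := by
      rw [hx, ← Real.exp_nat_mul]; congr 1; ring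
    have e2 : Real.exp (w * n) = (x ^ n)⁻¹ := by rw [← e1, ← Real.exp_neg, neg_neg]
    rw [Real.cosh_eq, e1, e2, hqx, zpow_neg, zpow_natCast, ← pow_mul, mul_comm 2 n, pow_mul]
    have : 0 < x ^ n := by positivity
    field_simp
    ring
  have hpreC : 2 * (-1 : ℂ) ^ n * ((q ^ (-(n : ℝ) / 2) : ℝ) : ℂ) / (1 + (q : ℂ) ^ (-(n : ℤ))) =
      (((-1) ^ n / Real.cosh (w * n) : ℝ) : ℂ) := by
    rw [hpow, ← hpre]; push_cast; rfl
  rw [hpreC, hhalf, basicHypergeom21, tsum_eq_sum (s := Finset.range (n + 1)), aeval_cnPoly_one hw,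
    Finset.mul_sum]
  · refine Finset.sum_congr rfl fun s hs => ?_
    rw [limitCoeff_eq_prod hw n s (by simpa [Nat.lt_succ_iff] using hs), ← hx, ← hqx, mul_pow]
    simp only [qShiftedFactorial, ← Finset.prod_mul_distrib, ← Finset.prod_div_distrib]
    push_cast
    ring
  · -- The series terminates because `(q^{-n}; q)_s` contains the factor `1 - q^{-n} q^n`.
    intro s hs
    have hs' : n < s := by simpa [Nat.lt_succ_iff] using hs
    have hq0 : (q : ℂ) ≠ 0 := by rw [hqx]; exact_mod_cast (pow_pos hx0 2).ne'
    have : qShiftedFactorial q ((q : ℂ) ^ (-(n : ℤ))) s = 0 := by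
      refine Finset.prod_eq_zero (Finset.mem_range.2 hs') ?_
      rw [zpow_neg, zpow_natCast, inv_mul_cancel₀ (pow_ne_zero _ hq0), sub_self]
    rw [this]; simp

/-! ### Telescoping sums of hyperbolic tangents -/

lemma tendsto_tanh_atTop : Tendsto Real.tanh atTop (𝓝 1) := by
  have h1 : Tendsto (fun x : ℝ => 1 - Real.exp (-x)) atTop (𝓝 (1 - 0)) :=
    tendsto_const_nhds.sub Real.tendsto_exp_neg_atTop_nhds_zero
  rw [sub_zero] at h1
  refine tendsto_of_tendsto_of_tendsto_of_le_of_le h1 tendsto_const_nhds (fun x => ?_)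
    fun x => (Real.tanh_lt_one x).le
  have hc := Real.one_le_cosh x
  have he := Real.exp_pos (-x)
  have h : Real.tanh x = 1 - Real.exp (-x) / Real.cosh x := by
    rw [Real.tanh_eq_sinh_div_cosh, ← Real.cosh_sub_sinh]
    have := Real.cosh_pos x
    field_simp
    ring
  rw [h]
  have : Real.exp (-x) / Real.cosh x ≤ Real.exp (-x) := div_le_self he.le hc
  linarith

lemma hasSum_nat_telescope {g : ℕ → ℝ} {L : ℝ} (hmono : Monotone g)
    (hg : Tendsto g atTop (𝓝 L)) : HasSum (fun n => g (n + 1) - g n) (L - g 0) := by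
  rw [hasSum_iff_tendsto_nat_of_nonneg fun n => sub_nonneg.2 (hmono n.le_succ)]
  simp only [Finset.sum_range_sub]
  exact hg.sub_const _

lemma tanh_sub_tanh (x y : ℝ) :
    Real.tanh x - Real.tanh y = Real.sinh (x - y) * (1 / Real.cosh x) * (1 / Real.cosh y) := by
  have := Real.cosh_pos x
  have := Real.cosh_pos y
  rw [Real.tanh_eq_sinh_div_cosh, Real.tanh_eq_sinh_div_cosh, Real.sinh_sub]
  field_simp

lemma tanh_strictMono : StrictMono Real.tanh := fun x y h => by
  have := Real.cosh_pos x
  have := Real.cosh_pos y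
  have h2 : 0 < Real.sinh (y - x) := Real.sinh_pos_iff.2 (by linarith)
  rw [← sub_pos, tanh_sub_tanh]
  positivity

/-- `HasSum.congr_fun` with an equation for the value of the sum. -/
lemma HasSum.of_eq_of_eq {ι : Type*} {f g : ι → ℝ} {a b : ℝ} (h : HasSum f a)
    (hf : ∀ i, g i = f i) (hab : b = a) : HasSum g b := by
  rw [hab]
  exact h.congr_fun hf

lemma hasSum_tanh_sub_tanh_sub_one {w : ℝ} (hw : 0 < w) :
    HasSum (fun l : ℤ => Real.tanh (w * l) - Real.tanh (w * ((l - 1 : ℤ) : ℝ))) 2 := by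
  have hlim : ∀ c : ℝ, Tendsto (fun n : ℕ => Real.tanh (w * ((n : ℝ) + c))) atTop (𝓝 1) :=
    fun c => tendsto_tanh_atTop.comp
      ((tendsto_natCast_atTop_atTop.atTop_add (tendsto_const_nhds (x := c))).const_mul_atTop hw)
  have hmono : ∀ c : ℝ, Monotone (fun n : ℕ => Real.tanh (w * ((n : ℝ) + c))) := fun c a b hab =>
    tanh_strictMono.monotone (by
      have : (a : ℝ) ≤ b := by exact_mod_cast hab
      nlinarith)
  have h1 := hasSum_nat_telescope (hmono (-1)) (hlim (-1))
  have h2 := hasSum_nat_telescope (hmono 1) (hlim 1)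
  have h := HasSum.of_nat_of_neg_add_one (m := 1 - Real.tanh (w * (((0 : ℕ) : ℝ) + -1)))
    (m' := 1 - Real.tanh (w * (((0 : ℕ) : ℝ) + 1)))
    (f := fun l : ℤ => Real.tanh (w * l) - Real.tanh (w * ((l - 1 : ℤ) : ℝ)))
    (h1.congr_fun fun n => ?_) (h2.congr_fun fun n => ?_)
  · refine h.of_eq_of_eq (fun _ => rfl) ?_
    push_cast
    rw [zero_add, zero_add, mul_neg, Real.tanh_neg]
    ring
  · push_cast
    ring_nf
  · push_cast
    rw [show w * (-((n : ℝ) + 1)) = -(w * ((n : ℝ) + 1)) by ring,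
      show w * (-((n : ℝ) + 1) - 1) = -(w * ((n : ℝ) + 1 + 1)) by ring, Real.tanh_neg,
      Real.tanh_neg]
    ring

lemma hasSum_tanh_sub_tanh_sub {w : ℝ} (hw : 0 < w) (m : ℤ) :
    HasSum (fun l : ℤ => Real.tanh (w * l) - Real.tanh (w * ((l - m : ℤ) : ℝ))) (2 * m) := by
  have hshift : ∀ k : ℤ, HasSum (fun l : ℤ => Real.tanh (w * ((l - k : ℤ) : ℝ)) -
      Real.tanh (w * ((l - k - 1 : ℤ) : ℝ))) 2 := fun k => by
    have h := (Equiv.subRight k).hasSum_iff.2 (hasSum_tanh_sub_tanh_sub_one hw)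
    refine h.of_eq_of_eq (fun l => ?_) rfl
    simp only [Function.comp, Equiv.subRight_apply]
  induction m using Int.induction_on with
  | zero => simp
  | succ i ih =>
    refine (ih.add (hshift i)).of_eq_of_eq (fun l => ?_) ?_
    · rw [show l - ((i : ℤ) + 1) = l - i - 1 by ring]
      ring
    · push_cast; ring
  | pred i ih =>
    refine (ih.sub (hshift (-i - 1))).of_eq_of_eq (fun l => ?_) ?_
    · rw [show l - (-(i : ℤ) - 1) - 1 = l - -(i : ℤ) by ring]
      ring
    · push_cast; ring

/-! ### The series `∑ n^j e^{nz} / cosh(wn)` -/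

/-- `1 / cosh(wn)`, the moments as a function of an integer. -/
noncomputable def sech (w : ℝ) (n : ℤ) : ℝ := 1 / Real.cosh (w * n)

lemma sech_pos (w : ℝ) (n : ℤ) : 0 < sech w n := one_div_pos.2 (Real.cosh_pos _)

@[simp] lemma sech_zero (w : ℝ) : sech w 0 = 1 := by simp [sech]

@[simp] lemma sech_neg (w : ℝ) (n : ℤ) : sech w (-n) = sech w n := by
  simp [sech, Real.cosh_neg]

lemma sech_le_one (w : ℝ) (n : ℤ) : sech w n ≤ 1 :=
  div_le_one_of_le₀ (Real.one_le_cosh _) (Real.cosh_pos _).le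

lemma sech_le_two_mul_exp {w : ℝ} (hw : 0 < w) (n : ℤ) :
    sech w n ≤ 2 * Real.exp (-(w * |(n : ℝ)|)) := by
  rw [sech, ← Real.cosh_abs, abs_mul, abs_of_pos hw, Real.cosh_eq, Real.exp_neg]
  have h := Real.exp_pos (w * |(n : ℝ)|)
  have h2 : 0 < (Real.exp (w * |(n : ℝ)|))⁻¹ := inv_pos.2 h
  rw [one_div_div, div_eq_mul_inv]
  exact mul_le_mul_of_nonneg_left (inv_anti₀ h (by linarith)) (by norm_num)

lemma summable_pow_mul_sech_mul_exp {w r : ℝ} (hw : 0 < w) (hr : r < w) (j : ℕ) :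
    Summable fun n : ℤ => |(n : ℝ)| ^ j * sech w n * Real.exp (|(n : ℝ)| * r) := by
  have hx : ‖Real.exp (r - w)‖ < 1 := by
    rw [Real.norm_of_nonneg (Real.exp_pos _).le]; simpa using hr
  have hgeom := (summable_pow_mul_geometric_of_norm_lt_one j hx).mul_left 2
  have hb : Summable fun n : ℤ => 2 * (|(n : ℝ)| ^ j * Real.exp (r - w) ^ n.natAbs) := by
    refine Summable.of_nat_of_neg ?_ ?_
    · refine hgeom.congr fun n => ?_
      simp
    · refine hgeom.congr fun n => ?_
      simp
  refine Summable.of_nonneg_of_le (fun n => ?_) (fun n => ?_) hb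
  · have := sech_pos w n
    positivity
  · have h := sech_le_two_mul_exp hw n
    have e : Real.exp (r - w) ^ n.natAbs = Real.exp (-(w * |(n : ℝ)|)) * Real.exp (|(n : ℝ)| * r) := by
      rw [← Real.exp_nat_mul, ← Real.exp_add, Nat.cast_natAbs, Int.cast_abs]
      congr 1; ring
    rw [e]
    calc |(n : ℝ)| ^ j * sech w n * Real.exp (|(n : ℝ)| * r)
        ≤ |(n : ℝ)| ^ j * (2 * Real.exp (-(w * |(n : ℝ)|))) * Real.exp (|(n : ℝ)| * r) := by
          gcongr
      _ = _ := by ring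

/-- The series `∑_{n ∈ ℤ} n^j e^{nz} / cosh(wn)`, which converges for `|Re z| < w`; it is the `j`-th
derivative of the series with `j = 0`. -/
noncomputable def sechSeries (w : ℝ) (j : ℕ) (z : ℂ) : ℂ :=
  ∑' n : ℤ, (n : ℂ) ^ j * sech w n * Complex.exp (n * z)

lemma norm_sechSeries_term_le {w r : ℝ} {z : ℂ} (hz : |z.re| ≤ r) (j : ℕ) (n : ℤ) :
    ‖(n : ℂ) ^ j * sech w n * Complex.exp (n * z)‖ ≤
      |(n : ℝ)| ^ j * sech w n * Real.exp (|(n : ℝ)| * r) := by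
  have hs := sech_pos w n
  rw [norm_mul, norm_mul, norm_pow, Complex.norm_intCast, Complex.norm_real,
    Real.norm_of_nonneg hs.le, Complex.norm_exp]
  have : ((n : ℂ) * z).re ≤ |(n : ℝ)| * r := by
    have h1 : ((n : ℂ) * z).re = n * z.re := by simp
    rw [h1]
    calc (n : ℝ) * z.re ≤ |(n : ℝ) * z.re| := le_abs_self _
      _ = |(n : ℝ)| * |z.re| := abs_mul _ _
      _ ≤ _ := by gcongr
  gcongr

lemma summable_norm_sechSeries {w : ℝ} (hw : 0 < w) {z : ℂ} (hz : |z.re| < w) (j : ℕ) :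
    Summable fun n : ℤ => ‖(n : ℂ) ^ j * sech w n * Complex.exp (n * z)‖ :=
  Summable.of_nonneg_of_le (fun _ => norm_nonneg _) (fun n => norm_sechSeries_term_le le_rfl j n)
    (summable_pow_mul_sech_mul_exp hw hz j)

lemma hasDerivAt_sechSeries {w : ℝ} (hw : 0 < w) {z : ℂ} (hz : |z.re| < w) (j : ℕ) :
    HasDerivAt (sechSeries w j) (sechSeries w (j + 1) z) z := by
  obtain ⟨r, hr1, hr2⟩ := exists_between hz
  have hopen : IsOpen {y : ℂ | |y.re| < r} :=
    isOpen_lt (Complex.continuous_re.abs) continuous_const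
  have hconv : Convex ℝ {y : ℂ | |y.re| < r} := by
    have : {y : ℂ | |y.re| < r} = Complex.reLm ⁻¹' (Set.Ioo (-r) r) := by
      ext y; simp [abs_lt]
    rw [this]
    exact (convex_Ioo _ _).linear_preimage _
  refine hasDerivAt_tsum_of_isPreconnected (summable_pow_mul_sech_mul_exp hw hr2 (j + 1)) hopen
    hconv.isPreconnected (g := fun (n : ℤ) (y : ℂ) => (n : ℂ) ^ j * sech w n * Complex.exp (n * y))
    (g' := fun (n : ℤ) (y : ℂ) => (n : ℂ) ^ (j + 1) * sech w n * Complex.exp (n * y)) ?_ ?_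
    (y₀ := z) hr1 (summable_norm_sechSeries hw hz j).of_norm hr1
  · intro n y _
    have := ((hasDerivAt_id y).const_mul (n : ℂ)).cexp.const_mul ((n : ℂ) ^ j * sech w n)
    refine this.congr_deriv ?_
    simp only [id, mul_one]
    ring
  · intro n y hy
    exact norm_sechSeries_term_le (le_of_lt hy) (j + 1) n

/-! ### Products of series indexed by the integers -/

/-- The equivalence `(n, m) ↦ (m, n - m)`. -/
def convolutionEquiv : ℤ × ℤ ≃ ℤ × ℤ where
  toFun p := (p.2, p.1 - p.2)
  invFun p := (p.1 + p.2, p.1)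
  left_inv p := by ext <;> simp
  right_inv p := by ext <;> simp

lemma summable_norm_mul_sub {a b : ℤ → ℂ} (ha : Summable fun n => ‖a n‖)
    (hb : Summable fun n => ‖b n‖) :
    Summable fun p : ℤ × ℤ => ‖a p.2 * b (p.1 - p.2)‖ :=
  convolutionEquiv.summable_iff.2 (ha.mul_norm hb)

lemma summable_convolution_apply {a b : ℤ → ℂ} (ha : Summable fun n => ‖a n‖)
    (hb : Summable fun n => ‖b n‖) (n : ℤ) : Summable fun m => a m * b (n - m) :=
  ((summable_norm_mul_sub ha hb).prod_factor n).of_norm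

lemma summable_norm_convolution {a b : ℤ → ℂ} (ha : Summable fun n => ‖a n‖)
    (hb : Summable fun n => ‖b n‖) : Summable fun n => ‖∑' m, a m * b (n - m)‖ :=
  Summable.of_nonneg_of_le (fun _ => norm_nonneg _)
    (fun n => norm_tsum_le_tsum_norm ((summable_norm_mul_sub ha hb).prod_factor n))
    (summable_norm_mul_sub ha hb).prod

lemma tsum_mul_tsum_eq_tsum_convolution {a b : ℤ → ℂ} (ha : Summable fun n => ‖a n‖)
    (hb : Summable fun n => ‖b n‖) :
    (∑' n, a n) * ∑' n, b n = ∑' n, ∑' m, a m * b (n - m) := by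
  rw [tsum_mul_tsum_of_summable_norm ha hb, ← convolutionEquiv.tsum_eq]
  exact (summable_norm_mul_sub ha hb).of_norm.tsum_prod

/-! ### The cube of the series -/

/-- The coefficients of the square of `∑ e^{nz} / cosh(wn)`. -/
noncomputable def sechSquare (w : ℝ) (n : ℤ) : ℝ := ∑' m : ℤ, sech w m * sech w (n - m)

/-- The coefficients of the cube of `∑ e^{nz} / cosh(wn)`. -/
noncomputable def sechCube (w : ℝ) (n : ℤ) : ℝ := ∑' m : ℤ, sechSquare w m * sech w (n - m)

lemma summable_norm_sech_mul_exp {w : ℝ} (hw : 0 < w) {z : ℂ} (hz : |z.re| < w) :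
    Summable fun n : ℤ => ‖(sech w n : ℂ) * Complex.exp (n * z)‖ := by
  simpa using summable_norm_sechSeries hw hz 0

lemma tsum_sech_mul_exp_convolution (w : ℝ) (z : ℂ) (n : ℤ) :
    ∑' m : ℤ, ((sech w m : ℂ) * Complex.exp (m * z)) *
      ((sech w (n - m) : ℂ) * Complex.exp ((n - m : ℤ) * z)) =
      (sechSquare w n : ℂ) * Complex.exp (n * z) := by
  rw [sechSquare, Complex.ofReal_tsum, ← tsum_mul_right]
  refine tsum_congr fun m => ?_
  rw [show (n : ℂ) * z = m * z + ((n - m : ℤ) : ℂ) * z by push_cast; ring, Complex.exp_add]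
  push_cast
  ring

lemma tsum_sechSquare_mul_exp_convolution (w : ℝ) (z : ℂ) (n : ℤ) :
    ∑' m : ℤ, ((sechSquare w m : ℂ) * Complex.exp (m * z)) *
      ((sech w (n - m) : ℂ) * Complex.exp ((n - m : ℤ) * z)) =
      (sechCube w n : ℂ) * Complex.exp (n * z) := by
  rw [sechCube, Complex.ofReal_tsum, ← tsum_mul_right]
  refine tsum_congr fun m => ?_
  rw [show (n : ℂ) * z = m * z + ((n - m : ℤ) : ℂ) * z by push_cast; ring, Complex.exp_add]
  push_cast
  ring

lemma summable_norm_sechSquare_mul_exp {w : ℝ} (hw : 0 < w) {z : ℂ} (hz : |z.re| < w) :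
    Summable fun n : ℤ => ‖(sechSquare w n : ℂ) * Complex.exp (n * z)‖ := by
  have h := summable_norm_sech_mul_exp hw hz
  simpa only [tsum_sech_mul_exp_convolution] using summable_norm_convolution h h

lemma sechSeries_zero_pow_three {w : ℝ} (hw : 0 < w) {z : ℂ} (hz : |z.re| < w) :
    sechSeries w 0 z ^ 3 = ∑' n : ℤ, (sechCube w n : ℂ) * Complex.exp (n * z) := by
  have h := summable_norm_sech_mul_exp hw hz
  have h2 := summable_norm_sechSquare_mul_exp hw hz
  have e0 : sechSeries w 0 z = ∑' n : ℤ, (sech w n : ℂ) * Complex.exp (n * z) := by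
    simp [sechSeries]
  have e1 := tsum_mul_tsum_eq_tsum_convolution h h
  have e2 := tsum_mul_tsum_eq_tsum_convolution h2 h
  simp only [tsum_sech_mul_exp_convolution] at e1
  simp only [tsum_sechSquare_mul_exp_convolution] at e2
  rw [← e2, ← e1, e0]
  ring

lemma summable_sechSquare_mul_sech {w : ℝ} (hw : 0 < w) (n : ℤ) :
    Summable fun m : ℤ => sechSquare w m * sech w (n - m) := by
  have h : Summable fun n : ℤ => ‖(sech w n : ℂ)‖ := by
    simpa using summable_norm_sech_mul_exp hw (z := 0) (by simpa using hw)
  have h2 : Summable fun n : ℤ => ‖(sechSquare w n : ℂ)‖ := by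
    simpa using summable_norm_sechSquare_mul_exp hw (z := 0) (by simpa using hw)
  have := summable_convolution_apply h2 h n
  exact_mod_cast this

/-- The convolution telescopes since `sinh(a + b) / (cosh a cosh b) = tanh a + tanh b`. -/
lemma sechSquare_mul_sinh {w : ℝ} (hw : 0 < w) (m : ℤ) :
    sechSquare w m * Real.sinh (w * m) = 2 * m := by
  rw [sechSquare, ← tsum_mul_right]
  rw [← (hasSum_tanh_sub_tanh_sub hw m).tsum_eq]
  refine tsum_congr fun l => ?_
  rw [tanh_sub_tanh, ← sech_neg w (m - l), sech, sech, neg_sub,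
    show w * (l : ℝ) - w * ((l - m : ℤ) : ℝ) = w * m by push_cast; ring]
  ring

lemma summable_int_mul_tanh_sub {w : ℝ} (hw : 0 < w) :
    Summable fun l : ℤ => (l : ℝ) * (Real.tanh (w * l) - Real.tanh (w * ((l - 1 : ℤ) : ℝ))) := by
  have h := (summable_pow_mul_sech_mul_exp hw hw 1).mul_left (Real.sinh w)
  refine Summable.of_norm_bounded h fun l => ?_
  have e := tanh_sub_tanh (w * l) (w * ((l - 1 : ℤ) : ℝ))
  rw [show w * (l : ℝ) - w * ((l - 1 : ℤ) : ℝ) = w by push_cast; ring] at e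
  change _ = Real.sinh w * sech w l * sech w (l - 1) at e
  have hs := sech_pos w l
  have hs1 := sech_pos w (l - 1)
  have hs2 := sech_le_one w (l - 1)
  have hw' : 0 < Real.sinh w := Real.sinh_pos_iff.2 hw
  rw [e, Real.norm_eq_abs, abs_mul, abs_of_pos (by positivity : 0 < Real.sinh w * sech w l * sech w (l - 1)),
    mul_zero, Real.exp_zero, mul_one, pow_one]
  have : 0 ≤ |(l : ℝ)| * (Real.sinh w * sech w l) := by positivity
  nlinarith

lemma hasSum_int_mul_tanh_sub {w : ℝ} (hw : 0 < w) :
    HasSum (fun l : ℤ => (l : ℝ) * (Real.tanh (w * l) - Real.tanh (w * ((l - 1 : ℤ) : ℝ)))) 1 := by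
  obtain ⟨S, hS⟩ := summable_int_mul_tanh_sub hw
  -- The differences are invariant under `l ↦ 1 - l`, which gives `S = 2 - S`.
  have h1 := (Equiv.subLeft (1 : ℤ)).hasSum_iff.2 hS
  have h2 := (hasSum_tanh_sub_tanh_sub_one hw).sub hS
  have h3 : HasSum (fun l : ℤ => (Real.tanh (w * l) - Real.tanh (w * ((l - 1 : ℤ) : ℝ))) -
      (l : ℝ) * (Real.tanh (w * l) - Real.tanh (w * ((l - 1 : ℤ) : ℝ)))) S := by
    refine h1.of_eq_of_eq (fun l => ?_) rfl
    simp only [Function.comp, Equiv.subLeft_apply]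
    push_cast
    rw [show w * (1 - (l : ℝ)) = -(w * ((l : ℝ) - 1)) by ring,
      show w * (1 - (l : ℝ) - 1) = -(w * l) by ring, Real.tanh_neg, Real.tanh_neg]
    ring
  have : S = 1 := by linarith [h3.unique h2]
  rwa [this] at hS

lemma sechCube_mul_cosh_succ {w : ℝ} (hw : 0 < w) (n : ℤ) :
    sechCube w (n + 1) * Real.cosh (w * ((n + 1 : ℤ) : ℝ)) - sechCube w n * Real.cosh (w * n) =
      4 * n + 2 := by
  have h1 := (summable_sechSquare_mul_sech hw (n + 1)).hasSum.mul_right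
    (Real.cosh (w * ((n + 1 : ℤ) : ℝ)))
  have h2 := (summable_sechSquare_mul_sech hw n).hasSum.mul_right (Real.cosh (w * n))
  have h3 := h1.sub h2
  have h4 : HasSum (fun l : ℤ => 2 * ((n : ℝ) + 1 - l) *
      (Real.tanh (w * l) - Real.tanh (w * ((l - 1 : ℤ) : ℝ)))) (4 * n + 2) := by
    refine (((hasSum_tanh_sub_tanh_sub_one hw).mul_left (2 * ((n : ℝ) + 1))).sub
      ((hasSum_int_mul_tanh_sub hw).mul_left 2)).of_eq_of_eq (fun l => ?_) ?_
    · ring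
    · ring
  have h5 := (Equiv.subLeft (n + 1)).hasSum_iff.2 h4
  refine h3.unique (h5.congr_fun fun m => ?_)
  simp only [Function.comp, Equiv.subLeft_apply]
  have key : ∀ k : ℤ, sechSquare w m * sech w (k - m) * Real.cosh (w * k) =
      sechSquare w m * Real.cosh (w * m) + 2 * m * Real.tanh (w * ((k - m : ℤ) : ℝ)) := by
    intro k
    have hc := Real.cosh_pos (w * ((k - m : ℤ) : ℝ))
    rw [← sechSquare_mul_sinh hw m, sech, Real.tanh_eq_sinh_div_cosh,
      show w * (k : ℝ) = w * m + w * ((k - m : ℤ) : ℝ) by push_cast; ring, Real.cosh_add]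
    field_simp
  rw [key, key, show n + 1 - m - 1 = n - m by ring]
  push_cast
  ring

lemma sechCube_mul_cosh {w : ℝ} (hw : 0 < w) (n : ℤ) :
    sechCube w n * Real.cosh (w * n) = 2 * (n : ℝ) ^ 2 + sechCube w 0 := by
  induction n using Int.induction_on with
  | zero => simp
  | succ i ih =>
    have := sechCube_mul_cosh_succ hw i
    push_cast at this ih ⊢
    linarith
  | pred i ih =>
    have := sechCube_mul_cosh_succ hw (-i - 1)
    rw [sub_add_cancel] at this
    push_cast at this ih ⊢
    linarith

/-- The series `F = ∑ e^{nz} / cosh(wn)` satisfies `F³ = 2 F'' + c F`. -/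
lemma sechSeries_pow_three_eq {w : ℝ} (hw : 0 < w) {z : ℂ} (hz : |z.re| < w) :
    sechSeries w 0 z ^ 3 = 2 * sechSeries w 2 z + sechCube w 0 * sechSeries w 0 z := by
  rw [sechSeries_zero_pow_three hw hz, sechSeries, sechSeries, ← tsum_mul_left, ← tsum_mul_left,
    ← Summable.tsum_add]
  · refine tsum_congr fun n => ?_
    have h : sechCube w n = (2 * (n : ℝ) ^ 2 + sechCube w 0) * sech w n := by
      rw [← sechCube_mul_cosh hw, sech]
      have := Real.cosh_pos (w * n)
      field_simp
    rw [h]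
    push_cast
    ring
  · exact (summable_norm_sechSeries hw hz 2).of_norm.mul_left _
  · exact (summable_norm_sechSeries hw hz 0).of_norm.mul_left _

/-! ### The series on the imaginary axis -/

lemma sechSeries_neg (w : ℝ) (j : ℕ) (z : ℂ) :
    sechSeries w j (-z) = (-1) ^ j * sechSeries w j z := by
  rw [sechSeries, sechSeries, ← (Equiv.neg ℤ).tsum_eq, ← tsum_mul_left]
  refine tsum_congr fun n => ?_
  simp only [Equiv.neg_apply, sech_neg]
  push_cast
  rw [neg_mul_neg, neg_pow]
  ring

lemma conj_sechSeries (w : ℝ) (j : ℕ) (z : ℂ) :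
    (starRingEnd ℂ) (sechSeries w j z) = sechSeries w j ((starRingEnd ℂ) z) := by
  rw [sechSeries, sechSeries, Complex.conj_tsum]
  refine tsum_congr fun n => ?_
  simp [← Complex.exp_conj]

/-- The real function `f(θ) = ∑ e^{inθ} / cosh(wn)`; up to scaling it is a Jacobi `dn`. -/
noncomputable def sechCircle (w θ : ℝ) : ℝ := (sechSeries w 0 (Complex.I * θ)).re

/-- The derivative of `sechCircle`. -/
noncomputable def sechCircleDeriv (w θ : ℝ) : ℝ :=
  (Complex.I * sechSeries w 1 (Complex.I * θ)).re

lemma abs_I_mul_re_lt {w : ℝ} (hw : 0 < w) (θ : ℝ) : |(Complex.I * (θ : ℂ)).re| < w := by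
  simpa using hw

lemma ofReal_sechCircle (w θ : ℝ) : (sechCircle w θ : ℂ) = sechSeries w 0 (Complex.I * θ) := by
  refine Complex.conj_eq_iff_re.1 ?_
  rw [conj_sechSeries]
  have h := sechSeries_neg w 0 (Complex.I * θ)
  simpa using h

lemma hasDerivAt_sechCircle {w : ℝ} (hw : 0 < w) (θ : ℝ) :
    HasDerivAt (sechCircle w) (sechCircleDeriv w θ) θ := by
  have h1 : HasDerivAt (fun z : ℂ => Complex.I * z) Complex.I (θ : ℂ) := by
    simpa using (hasDerivAt_id (θ : ℂ)).const_mul Complex.I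
  have h2 := (hasDerivAt_sechSeries hw (abs_I_mul_re_lt hw θ) 0).comp (θ : ℂ) h1
  have h3 := h2.real_of_complex
  rw [zero_add, mul_comm] at h3
  exact h3

lemma hasDerivAt_sechCircleDeriv {w : ℝ} (hw : 0 < w) (θ : ℝ) :
    HasDerivAt (sechCircleDeriv w)
      (sechCube w 0 / 2 * sechCircle w θ - sechCircle w θ ^ 3 / 2) θ := by
  have h1 : HasDerivAt (fun z : ℂ => Complex.I * z) Complex.I (θ : ℂ) := by
    simpa using (hasDerivAt_id (θ : ℂ)).const_mul Complex.I
  have h2 := ((hasDerivAt_sechSeries hw (abs_I_mul_re_lt hw θ) 1).comp (θ : ℂ) h1).const_mul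
    Complex.I
  have h3 := h2.real_of_complex
  refine h3.congr_deriv ?_
  have h4 := sechSeries_pow_three_eq hw (abs_I_mul_re_lt hw θ)
  rw [← ofReal_sechCircle] at h4
  have h5 : Complex.I * (sechSeries w (1 + 1) (Complex.I * θ) * Complex.I) =
      ((sechCube w 0 / 2 * sechCircle w θ - sechCircle w θ ^ 3 / 2 : ℝ) : ℂ) := by
    push_cast
    linear_combination sechSeries w 2 (Complex.I * θ) * Complex.I_sq + h4 / 2
  rw [h5, Complex.ofReal_re]

lemma continuous_sechCircle {w : ℝ} (hw : 0 < w) : Continuous (sechCircle w) :=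
  continuous_iff_continuousAt.2 fun θ => (hasDerivAt_sechCircle hw θ).continuousAt

lemma hasSum_sechCircle {w : ℝ} (hw : 0 < w) (θ : ℝ) :
    HasSum (fun n : ℤ => sech w n * Real.cos (n * θ)) (sechCircle w θ) := by
  have h := Complex.hasSum_re (summable_norm_sechSeries hw (abs_I_mul_re_lt hw θ) 0).of_norm.hasSum
  refine h.of_eq_of_eq (fun n => ?_) rfl
  have e : (n : ℂ) * (Complex.I * θ) = ((n * θ : ℝ) : ℂ) * Complex.I := by push_cast; ring
  rw [pow_zero, one_mul, e, Complex.re_ofReal_mul, Complex.exp_ofReal_mul_I_re]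

lemma sechCircle_two_pi_sub {w : ℝ} (hw : 0 < w) (θ : ℝ) :
    sechCircle w (2 * Real.pi - θ) = sechCircle w θ := by
  refine (hasSum_sechCircle hw _).unique ((hasSum_sechCircle hw θ).of_eq_of_eq (fun n => ?_) rfl)
  rw [mul_sub, Real.cos_int_mul_two_pi_sub]

lemma sechCircleDeriv_zero (w : ℝ) : sechCircleDeriv w 0 = 0 := by
  have h := sechSeries_neg w 1 0
  have h0 : sechSeries w 1 0 = 0 := by
    rw [neg_zero, pow_one] at h
    linear_combination h / 2
  simp [sechCircleDeriv, h0]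

lemma sechCircle_zero_pos {w : ℝ} (hw : 0 < w) : 0 < sechCircle w 0 := by
  have h := hasSum_sechCircle hw 0
  simp only [mul_zero, Real.cos_zero, mul_one] at h
  exact (sech_pos w 0).trans_le (le_hasSum h 0 fun n _ => (sech_pos w n).le)

lemma abs_sechCircle_pi_lt {w : ℝ} (hw : 0 < w) : |sechCircle w Real.pi| < sechCircle w 0 := by
  have h0 := hasSum_sechCircle hw 0
  simp only [mul_zero, Real.cos_zero, mul_one] at h0
  have hπ := hasSum_sechCircle hw Real.pi
  have hb : ∀ n : ℤ, |sech w n * Real.cos (n * Real.pi)| ≤ sech w n := fun n => by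
    rw [abs_mul, abs_of_pos (sech_pos w n)]
    exact mul_le_of_le_one_right (sech_pos w n).le (Real.abs_cos_le_one _)
  rw [abs_lt]
  constructor
  · refine hasSum_lt (i := 0) (fun n => ?_) ?_ h0.neg hπ
    · exact (abs_le.1 (hb n)).1
    · simp
  · refine hasSum_lt (i := 1) (fun n => ?_) ?_ hπ h0
    · exact (abs_le.1 (hb n)).2
    · have := sech_pos w 1
      simp
      linarith

/-- The Fourier coefficients of `sechCircle`. -/
lemma integral_sechCircle_mul_exp {w : ℝ} (hw : 0 < w) (m : ℤ) :
    ∫ θ in (0 : ℝ)..(2 * Real.pi), (sechCircle w θ : ℂ) * Complex.exp (m * θ * Complex.I) =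
      2 * Real.pi * sech w m := by
  let F : ℤ → C(ℝ, ℂ) := fun n =>
    ⟨fun θ => (sech w n : ℂ) * Complex.exp (((n + m : ℤ) : ℂ) * Complex.I * θ), by fun_prop⟩
  have hnorm : ∀ n θ, ‖F n θ‖ ≤ sech w n := fun n θ => by
    have e : ((n + m : ℤ) : ℂ) * Complex.I * θ = (((n + m : ℤ) * θ : ℝ) : ℂ) * Complex.I := by
      push_cast; ring
    change ‖(sech w n : ℂ) * Complex.exp (((n + m : ℤ) : ℂ) * Complex.I * θ)‖ ≤ _
    rw [e, norm_mul, Complex.norm_exp_ofReal_mul_I, Complex.norm_real,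
      Real.norm_of_nonneg (sech_pos w n).le, mul_one]
  have hsum : Summable fun n : ℤ => sech w n := by
    simpa using summable_pow_mul_sech_mul_exp hw hw 0
  have h := intervalIntegral.hasSum_intervalIntegral_of_summable_norm (f := F) (a := 0)
    (b := 2 * Real.pi) (Summable.of_nonneg_of_le (fun _ => norm_nonneg _) (fun n => by
      rw [ContinuousMap.norm_le _ (sech_pos w n).le]
      exact fun x => hnorm n x) hsum)
  have hint : ∀ θ : ℝ, ∑' n, F n θ = (sechCircle w θ : ℂ) * Complex.exp (m * θ * Complex.I) := by
    intro θ
    rw [ofReal_sechCircle, sechSeries, ← tsum_mul_right]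
    refine tsum_congr fun n => ?_
    change (sech w n : ℂ) * Complex.exp (((n + m : ℤ) : ℂ) * Complex.I * θ) = _
    rw [pow_zero, one_mul, mul_assoc _ (Complex.exp _), ← Complex.exp_add]
    congr 2; push_cast; ring
  simp only [hint] at h
  refine h.unique ?_
  have hval : ∀ n : ℤ, n ≠ -m → ∫ θ in (0 : ℝ)..(2 * Real.pi), F n θ = 0 := by
    intro n hn
    change ∫ θ in (0 : ℝ)..(2 * Real.pi),
      (sech w n : ℂ) * Complex.exp (((n + m : ℤ) : ℂ) * Complex.I * θ) = 0
    have hne : ((n + m : ℤ) : ℂ) * Complex.I ≠ 0 := by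
      refine mul_ne_zero (Int.cast_ne_zero.2 fun h => hn (by omega)) Complex.I_ne_zero
    rw [intervalIntegral.integral_const_mul, integral_exp_mul_complex hne]
    have e : ((n + m : ℤ) : ℂ) * Complex.I * ((2 * Real.pi : ℝ) : ℂ) =
        ((n + m : ℤ) : ℂ) * (2 * Real.pi * Complex.I) := by push_cast; ring
    rw [e, Complex.exp_int_mul_two_pi_mul_I]
    simp
  have hval' : ∫ θ in (0 : ℝ)..(2 * Real.pi), F (-m) θ = 2 * Real.pi * sech w m := by
    change ∫ θ in (0 : ℝ)..(2 * Real.pi),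
      (sech w (-m) : ℂ) * Complex.exp (((-m + m : ℤ) : ℂ) * Complex.I * θ) = _
    simp
  exact hval' ▸ hasSum_single (-m) hval

lemma integral_sechCircle_two_pi {w : ℝ} (hw : 0 < w) :
    ∫ θ in (0 : ℝ)..(2 * Real.pi), sechCircle w θ = 2 * Real.pi := by
  have h := integral_sechCircle_mul_exp hw 0
  simp only [Int.cast_zero, zero_mul, Complex.exp_zero, mul_one, sech_zero, Complex.ofReal_one,
    intervalIntegral.integral_ofReal] at h
  exact_mod_cast h

lemma integral_sechCircle_pi {w : ℝ} (hw : 0 < w) :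
    ∫ θ in (0 : ℝ)..Real.pi, sechCircle w θ = Real.pi := by
  have h1 := intervalIntegral.integral_comp_sub_left (a := 0) (b := Real.pi) (sechCircle w)
    (2 * Real.pi)
  simp only [sechCircle_two_pi_sub hw, sub_zero] at h1
  rw [show 2 * Real.pi - Real.pi = Real.pi by ring] at h1
  have h2 := intervalIntegral.integral_add_adjacent_intervals
    ((continuous_sechCircle hw).intervalIntegrable (μ := volume) 0 Real.pi)
    ((continuous_sechCircle hw).intervalIntegrable (μ := volume) Real.pi (2 * Real.pi))
  rw [← h1, integral_sechCircle_two_pi hw] at h2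
  linarith

/-! ### Identification with the Jacobi function `dn` -/

section Amplitude

variable {f f' φ : ℝ → ℝ} {A B : ℝ}

/-- If `f'' = (A + B) f / 4 - f³ / 2` with `f(0)² = A`, `f'(0) = 0`, and if `φ' = f / 2`,
`φ(0) = 0`, then `f² = A cos² φ + B sin² φ`. The two defects `X`, `Y` satisfy the linear system
`X' = 2fY`, `Y' = -fX/2`, for which `X² + 4Y²` is constant. -/
lemma sq_eq_of_cubic_ode (hf : ∀ t, HasDerivAt f (f' t) t)
    (hf' : ∀ t, HasDerivAt f' ((A + B) / 4 * f t - f t ^ 3 / 2) t)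
    (hφ : ∀ t, HasDerivAt φ (f t / 2) t) (h0 : f 0 ^ 2 = A) (h0' : f' 0 = 0) (hφ0 : φ 0 = 0)
    (t : ℝ) :
    f t ^ 2 = A * Real.cos (φ t) ^ 2 + B * Real.sin (φ t) ^ 2 ∧
      f' t = -((A - B) / 2 * (Real.sin (φ t) * Real.cos (φ t))) := by
  set X : ℝ → ℝ := fun t => f t ^ 2 - A * Real.cos (φ t) ^ 2 - B * Real.sin (φ t) ^ 2 with hX
  set Y : ℝ → ℝ := fun t => f' t + (A - B) / 2 * (Real.sin (φ t) * Real.cos (φ t)) with hY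
  have dX : ∀ t, HasDerivAt X (2 * f t * Y t) t := fun t => by
    have := (((hf t).pow 2).sub (((hφ t).cos.pow 2).const_mul A)).sub
      (((hφ t).sin.pow 2).const_mul B)
    refine this.congr_deriv ?_
    simp only [hY]
    push_cast
    ring
  have dY : ∀ t, HasDerivAt Y (-(f t / 2 * X t)) t := fun t => by
    have := (hf' t).add (((hφ t).sin.mul (hφ t).cos).const_mul ((A - B) / 2))
    refine this.congr_deriv ?_
    simp only [hX]
    linear_combination (A + B) / 4 * f t * (-Real.sin_sq_add_cos_sq (φ t))
  have dE : ∀ t, HasDerivAt (fun t => X t ^ 2 + 4 * Y t ^ 2) 0 t := fun t => by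
    have := ((dX t).pow 2).add (((dY t).pow 2).const_mul 4)
    refine this.congr_deriv ?_
    push_cast
    ring
  have hE := is_const_of_deriv_eq_zero (fun t => (dE t).differentiableAt) (fun t => (dE t).deriv) t 0
  have hX0 : X 0 = 0 := by simp [hX, hφ0, h0]
  have hY0 : Y 0 = 0 := by simp [hY, hφ0, h0']
  simp only [hX0, hY0] at hE
  have hXt : X t = 0 := by nlinarith [sq_nonneg (X t), sq_nonneg (Y t)]
  have hYt : Y t = 0 := by nlinarith [sq_nonneg (X t), sq_nonneg (Y t)]
  simp only [hX, hY] at hXt hYt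
  exact ⟨by linarith, by linarith⟩

/-- Where `φ = π/2` one has `f² = B`, so `B ≥ 0`. For `B = 0` it would follow that
`|f'| ≤ √A |f| / 2`, so that `f² e^{√A t}` is increasing and `f` cannot reach zero. -/
lemma pos_of_cubic_ode {a s : ℝ} (ha : 0 < a) (hs : 0 ≤ s) (hf : ∀ t, HasDerivAt f (f' t) t)
    (h0 : f 0 = a)
    (hsq : ∀ t, f t ^ 2 = a ^ 2 * Real.cos (φ t) ^ 2 + B * Real.sin (φ t) ^ 2 ∧
      f' t = -((a ^ 2 - B) / 2 * (Real.sin (φ t) * Real.cos (φ t))))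
    (hφ : φ s = Real.pi / 2) : 0 < B := by
  have hB : f s ^ 2 = B := by simpa [hφ] using (hsq s).1
  refine (hB ▸ sq_nonneg (f s)).lt_of_ne fun hB0 => ?_
  rw [← hB0] at hB
  have dh : ∀ t, HasDerivAt (fun t => f t ^ 2 * Real.exp (a * t))
      ((2 * f t * f' t + a * f t ^ 2) * Real.exp (a * t)) t := fun t => by
    have := ((hf t).pow 2).mul (((hasDerivAt_id t).const_mul a).exp)
    refine this.congr_deriv ?_
    simp only [id, Pi.pow_apply]
    push_cast
    ring
  have hmono : Monotone fun t => f t ^ 2 * Real.exp (a * t) := by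
    refine monotone_of_deriv_nonneg (fun t => (dh t).differentiableAt) fun t => ?_
    rw [(dh t).deriv]
    refine mul_nonneg ?_ (Real.exp_pos _).le
    obtain ⟨h1, h2⟩ := hsq t
    rw [← hB0] at h1 h2
    have h3 : f' t ^ 2 ≤ (a / 2 * f t) ^ 2 := by
      have hs1 := Real.sin_sq_le_one (φ t)
      have : f' t ^ 2 = a ^ 4 / 4 * Real.cos (φ t) ^ 2 * Real.sin (φ t) ^ 2 := by rw [h2]; ring
      rw [this, mul_pow, h1]
      have hc : 0 ≤ a ^ 4 / 4 * Real.cos (φ t) ^ 2 := by positivity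
      nlinarith
    have h4 := sq_le_sq.1 h3
    have h5 : |f t * f' t| ≤ a / 2 * f t ^ 2 := by
      rw [abs_mul]
      rw [abs_mul, abs_of_pos (by positivity : 0 < a / 2)] at h4
      calc |f t| * |f' t| ≤ |f t| * (a / 2 * |f t|) := by gcongr
        _ = a / 2 * f t ^ 2 := by rw [← sq_abs (f t)]; ring
    linarith [(abs_le.1 h5).1]
  have := hmono hs
  simp only [h0, hB, mul_zero, Real.exp_zero, mul_one, zero_mul] at this
  nlinarith

end Amplitude

/-- The amplitude `φ(θ) = ½ ∫₀^θ f` attached to `f = sechCircle w`. -/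
noncomputable def sechAmplitude (w θ : ℝ) : ℝ := ∫ t in (0 : ℝ)..θ, sechCircle w t / 2

/-- The square of the minimum of `f = sechCircle w`; the maximum is `f(0)`. It is defined through
`f'' = (A + B) f / 4 - f³ / 2` with `A = f(0)²`. -/
noncomputable def sechMinSq (w : ℝ) : ℝ := 2 * sechCube w 0 - sechCircle w 0 ^ 2

/-- The modulus `k ∈ (0, 1)` with `w = π K'(k) / K(k)`. -/
noncomputable def sechModulus (w : ℝ) : ℝ := √(1 - sechMinSq w / sechCircle w 0 ^ 2)

section

variable {w : ℝ} (hw : 0 < w)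
include hw

lemma hasDerivAt_sechAmplitude (θ : ℝ) :
    HasDerivAt (sechAmplitude w) (sechCircle w θ / 2) θ :=
  ((continuous_sechCircle hw).div_const 2).integral_hasStrictDerivAt 0 θ |>.hasDerivAt

lemma sechAmplitude_pi : sechAmplitude w Real.pi = Real.pi / 2 := by
  rw [sechAmplitude, intervalIntegral.integral_div, integral_sechCircle_pi hw]

lemma sechCircle_sq (θ : ℝ) :
    sechCircle w θ ^ 2 = sechCircle w 0 ^ 2 * Real.cos (sechAmplitude w θ) ^ 2 +
      sechMinSq w * Real.sin (sechAmplitude w θ) ^ 2 ∧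
    sechCircleDeriv w θ = -((sechCircle w 0 ^ 2 - sechMinSq w) / 2 *
      (Real.sin (sechAmplitude w θ) * Real.cos (sechAmplitude w θ))) := by
  refine sq_eq_of_cubic_ode (hasDerivAt_sechCircle hw) (fun t => ?_) (hasDerivAt_sechAmplitude hw)
    rfl (sechCircleDeriv_zero w) (by simp [sechAmplitude]) θ
  refine (hasDerivAt_sechCircleDeriv hw t).congr_deriv ?_
  rw [sechMinSq]
  ring

lemma sechMinSq_pos : 0 < sechMinSq w :=
  pos_of_cubic_ode (sechCircle_zero_pos hw) Real.pi_pos.le (hasDerivAt_sechCircle hw) rfl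
    (sechCircle_sq hw) (sechAmplitude_pi hw)

lemma sechMinSq_lt : sechMinSq w < sechCircle w 0 ^ 2 := by
  have h : sechCircle w Real.pi ^ 2 = sechMinSq w := by
    simpa [sechAmplitude_pi hw] using (sechCircle_sq hw Real.pi).1
  rw [← h]
  exact sq_lt_sq' (abs_lt.1 (abs_sechCircle_pi_lt hw)).1 (abs_lt.1 (abs_sechCircle_pi_lt hw)).2

lemma sechCircle_pos (θ : ℝ) : 0 < sechCircle w θ := by
  by_contra! h
  obtain ⟨t, ht⟩ := mem_range_of_exists_le_of_exists_ge (continuous_sechCircle hw) ⟨θ, h⟩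
    ⟨0, (sechCircle_zero_pos hw).le⟩
  have h1 := (sechCircle_sq hw t).1
  have h2 := sechMinSq_pos hw
  have h3 := sechMinSq_lt hw
  have h4 := Real.sin_sq_add_cos_sq (sechAmplitude w t)
  rw [ht] at h1
  nlinarith [sq_nonneg (Real.cos (sechAmplitude w t))]

lemma sechModulus_sq : sechModulus w ^ 2 = 1 - sechMinSq w / sechCircle w 0 ^ 2 := by
  refine Real.sq_sqrt (sub_nonneg.2 ?_)
  exact (div_lt_one (pow_pos (sechCircle_zero_pos hw) 2)).2 (sechMinSq_lt hw) |>.le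

lemma sechModulus_mem : sechModulus w ∈ Set.Ioo (0 : ℝ) 1 := by
  have h0 := pow_pos (sechCircle_zero_pos hw) 2
  have h1 := (div_lt_one h0).2 (sechMinSq_lt hw)
  have h2 := div_pos (sechMinSq_pos hw) h0
  have h3 := sechModulus_sq hw
  have h4 : 0 < sechModulus w := Real.sqrt_pos.2 (by linarith)
  exact ⟨h4, by nlinarith⟩

lemma sechModulus_sq_lt_one : sechModulus w ^ 2 < 1 := by
  have := sechModulus_mem hw
  nlinarith [this.1, this.2]

lemma sqrt_one_sub_sechModulus_sq_mul (θ : ℝ) :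
    √(1 - sechModulus w ^ 2 * Real.sin (sechAmplitude w θ) ^ 2) =
      sechCircle w θ / sechCircle w 0 := by
  have h0 := sechCircle_zero_pos hw
  have h1 := sechCircle_pos hw θ
  rw [← Real.sqrt_sq (div_pos h1 h0).le]
  congr 1
  rw [sechModulus_sq hw, div_pow, (sechCircle_sq hw θ).1]
  have h2 := Real.sin_sq_add_cos_sq (sechAmplitude w θ)
  field_simp
  linear_combination -sechCircle w 0 ^ 2 * h2

lemma ellipticF_sechAmplitude (θ : ℝ) :
    ellipticF (sechModulus w) (sechAmplitude w θ) = sechCircle w 0 / 2 * θ := by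
  have hk := sechModulus_sq_lt_one hw
  have hd : ∀ t, HasDerivAt (fun t => ellipticF (sechModulus w) (sechAmplitude w t) -
      sechCircle w 0 / 2 * t) 0 t := fun t => by
    have := ((hasDerivAt_ellipticF hk _).comp t (hasDerivAt_sechAmplitude hw t)).sub
      ((hasDerivAt_id t).const_mul (sechCircle w 0 / 2))
    refine this.congr_deriv ?_
    rw [ellipticIntegrand, sqrt_one_sub_sechModulus_sq_mul hw]
    have h0 := sechCircle_zero_pos hw
    have h1 := sechCircle_pos hw t
    field_simp
    ring
  have := is_const_of_deriv_eq_zero (fun t => (hd t).differentiableAt) (fun t => (hd t).deriv) θ 0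
  have h0 : sechAmplitude w 0 = 0 := by simp [sechAmplitude]
  simp only [h0, ellipticF_zero] at this
  linarith

lemma ellipticK_sechModulus : ellipticK (sechModulus w) = sechCircle w 0 / 2 * Real.pi := by
  rw [ellipticK_eq_ellipticF, ← sechAmplitude_pi hw, ellipticF_sechAmplitude hw]

/-- The Fourier expansion of `dn`. -/
lemma dnWeight_sechModulus (θ : ℝ) :
    dnWeight (sechModulus w) θ = sechCircle w θ / (2 * Real.pi) := by
  have hπ := Real.pi_pos
  have h0 := sechCircle_zero_pos hw
  have e : ellipticK (sechModulus w) * θ / Real.pi =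
      ellipticF (sechModulus w) (sechAmplitude w θ) := by
    rw [ellipticF_sechAmplitude hw, ellipticK_sechModulus hw]
    field_simp
  rw [dnWeight, e, jacobiDn, jacobiSn, jacobiAm_ellipticF (sechModulus_sq_lt_one hw),
    sqrt_one_sub_sechModulus_sq_mul hw, ellipticK_sechModulus hw]
  field_simp

end

/-! ### The series on the real axis and the complementary integral -/

/-- The real function `g(τ) = ∑ e^{nτ} / cosh(wn)`, `|τ| < w`. -/
noncomputable def sechLine (w τ : ℝ) : ℝ := (sechSeries w 0 τ).re

/-- The derivative of `sechLine`. -/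
noncomputable def sechLineDeriv (w τ : ℝ) : ℝ := (sechSeries w 1 τ).re

lemma sechLine_zero (w : ℝ) : sechLine w 0 = sechCircle w 0 := by
  simp [sechLine, sechCircle]

lemma ofReal_sechLine (w τ : ℝ) : (sechLine w τ : ℂ) = sechSeries w 0 τ := by
  refine Complex.conj_eq_iff_re.1 ?_
  rw [conj_sechSeries, Complex.conj_ofReal]

lemma sechLine_neg (w τ : ℝ) : sechLine w (-τ) = sechLine w τ := by
  have := sechSeries_neg w 0 τ
  simp only [pow_zero, one_mul] at this
  rw [sechLine, Complex.ofReal_neg, this, sechLine]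

lemma sechLineDeriv_neg (w τ : ℝ) : sechLineDeriv w (-τ) = -sechLineDeriv w τ := by
  have := sechSeries_neg w 1 τ
  rw [sechLineDeriv, Complex.ofReal_neg, this, sechLineDeriv]
  simp

section

variable {w τ : ℝ} (hw : 0 < w) (hτ : |τ| < w)
include hw hτ

lemma hasDerivAt_sechLine : HasDerivAt (sechLine w) (sechLineDeriv w τ) τ :=
  (hasDerivAt_sechSeries hw (z := τ) (by simpa using hτ) 0).real_of_complex

lemma hasDerivAt_sechLineDeriv :
    HasDerivAt (sechLineDeriv w)
      (sechLine w τ * (2 * sechLine w τ ^ 2 - sechCircle w 0 ^ 2 - sechMinSq w) / 4) τ := by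
  have hz : |(τ : ℂ).re| < w := by simpa using hτ
  refine (hasDerivAt_sechSeries hw hz 1).real_of_complex.congr_deriv ?_
  have h := sechSeries_pow_three_eq hw hz
  rw [← ofReal_sechLine] at h
  have h2 : sechSeries w (1 + 1) τ =
      ((sechLine w τ * (2 * sechLine w τ ^ 2 - sechCircle w 0 ^ 2 - sechMinSq w) / 4 : ℝ) : ℂ) := by
    rw [sechMinSq]
    push_cast
    linear_combination -h / 2
  rw [h2, Complex.ofReal_re]

lemma hasSum_sechLine : HasSum (fun n : ℤ => sech w n * Real.exp (n * τ)) (sechLine w τ) := by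
  have h := Complex.hasSum_re
    (summable_norm_sechSeries hw (z := τ) (by simpa using hτ) 0).of_norm.hasSum
  refine h.of_eq_of_eq (fun n => ?_) rfl
  have e : (n : ℂ) * τ = ((n * τ : ℝ) : ℂ) := by push_cast; ring
  rw [pow_zero, one_mul, e, Complex.re_ofReal_mul, Complex.exp_ofReal_re]

lemma hasSum_sechLineDeriv :
    HasSum (fun n : ℤ => n * sech w n * Real.exp (n * τ)) (sechLineDeriv w τ) := by
  have h := Complex.hasSum_re
    (summable_norm_sechSeries hw (z := τ) (by simpa using hτ) 1).of_norm.hasSum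
  refine h.of_eq_of_eq (fun n => ?_) rfl
  have e : (n : ℂ) ^ 1 * sech w n * Complex.exp (n * τ) =
      ((n * sech w n * Real.exp (n * τ) : ℝ) : ℂ) := by push_cast; ring
  rw [e, Complex.ofReal_re]

lemma sechCircle_zero_le_sechLine : sechCircle w 0 ≤ sechLine w τ := by
  have h1 := hasSum_sechLine hw hτ
  have h2 := hasSum_sechLine hw (τ := -τ) (by simpa using hτ)
  rw [sechLine_neg] at h2
  have h3 := (h1.add h2).div_const 2
  have h0 := hasSum_sechCircle hw 0
  have h4 := hasSum_le (fun n => ?_) h0 h3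
  · linarith
  · have hc := Real.one_le_cosh (n * τ)
    have hs := sech_pos w n
    rw [Real.cosh_eq] at hc
    rw [mul_zero, Real.cos_zero, mul_one, mul_neg]
    nlinarith

lemma sechLineDeriv_nonneg (h0 : 0 ≤ τ) : 0 ≤ sechLineDeriv w τ := by
  have h1 := hasSum_sechLineDeriv hw hτ
  have h2 := hasSum_sechLineDeriv hw (τ := -τ) (by simpa using hτ)
  rw [sechLineDeriv_neg] at h2
  have h3 := (h1.sub h2).div_const 2
  have h4 := h3.nonneg fun n => ?_
  · linarith
  · have hs := sech_pos w n
    rw [mul_neg, ← mul_sub]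
    have : 0 ≤ (n : ℝ) * (Real.exp (n * τ) - Real.exp (-(n * τ))) := by
      rcases le_total 0 (n : ℝ) with hn | hn
      · exact mul_nonneg hn (sub_nonneg.2 (Real.exp_le_exp.2 (by nlinarith)))
      · exact mul_nonneg_of_nonpos_of_nonpos hn
          (sub_nonpos.2 (Real.exp_le_exp.2 (by nlinarith)))
    have e : n * sech w n * (Real.exp (n * τ) - Real.exp (-(n * τ))) / 2 =
      sech w n * (n * (Real.exp (n * τ) - Real.exp (-(n * τ)))) / 2 := by ring
    rw [e]
    positivity

lemma sechLineDeriv_sq :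
    sechLineDeriv w τ ^ 2 =
      (sechLine w τ ^ 2 - sechCircle w 0 ^ 2) * (sechLine w τ ^ 2 - sechMinSq w) / 4 := by
  have hd : ∀ t ∈ Set.Ioo (-w) w, HasDerivAt (fun t => sechLineDeriv w t ^ 2 -
      (sechLine w t ^ 2 - sechCircle w 0 ^ 2) * (sechLine w t ^ 2 - sechMinSq w) / 4) 0 t := by
    intro t ht
    have ht' : |t| < w := abs_lt.2 ht
    have h1 := hasDerivAt_sechLine hw ht'
    have := ((hasDerivAt_sechLineDeriv hw ht').pow 2).sub
      ((((h1.pow 2).sub_const (sechCircle w 0 ^ 2)).mul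
        ((h1.pow 2).sub_const (sechMinSq w))).div_const 4)
    refine this.congr_deriv ?_
    simp only [Pi.pow_apply]
    push_cast
    ring
  have := isOpen_Ioo.is_const_of_deriv_eq_zero isPreconnected_Ioo
    (fun t ht => (hd t ht).differentiableAt.differentiableWithinAt) (fun t ht => (hd t ht).deriv)
    (abs_lt.1 hτ) (Set.mem_Ioo.2 ⟨neg_lt_zero.2 hw, hw⟩)
  have h0 : sechLineDeriv w 0 = 0 := by
    have := sechLineDeriv_neg w 0
    rw [neg_zero] at this
    linarith
  simp only [h0, sechLine_zero] at this
  linarith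

lemma sechMinSq_lt_sechLine_sq : sechMinSq w < sechLine w τ ^ 2 :=
  (sechMinSq_lt hw).trans_le
    (pow_le_pow_left₀ (sechCircle_zero_pos hw).le (sechCircle_zero_le_sechLine hw hτ) 2)

end

/-- `tan ψ` for the amplitude `ψ(τ)` with `g = f(0) √(1 - k'² sin² ψ) / cos ψ`, where `g = sechLine w`
and `k'² = 1 - k²`. Writing it with `g'` instead of `√(g² - f(0)²)` makes it differentiable at
`τ = 0`. -/
noncomputable def sechTan (w τ : ℝ) : ℝ :=
  2 * sechLineDeriv w τ /
    (√(sechCircle w 0 ^ 2 - sechMinSq w) * √(sechLine w τ ^ 2 - sechMinSq w))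

lemma sechTan_sq {w τ : ℝ} (hw : 0 < w) (hτ : |τ| < w) :
    sechTan w τ ^ 2 =
      (sechLine w τ ^ 2 - sechCircle w 0 ^ 2) / (sechCircle w 0 ^ 2 - sechMinSq w) := by
  have hA := sub_pos.2 (sechMinSq_lt hw)
  have hU := sub_pos.2 (sechMinSq_lt_sechLine_sq hw hτ)
  rw [sechTan, div_pow, mul_pow, mul_pow, Real.sq_sqrt hA.le, Real.sq_sqrt hU.le,
    sechLineDeriv_sq hw hτ]
  field_simp
  ring

lemma hasDerivAt_sechTan {w τ : ℝ} (hw : 0 < w) (hτ : |τ| < w) :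
    HasDerivAt (sechTan w) (sechLine w τ * √(sechLine w τ ^ 2 - sechMinSq w) /
      (2 * √(sechCircle w 0 ^ 2 - sechMinSq w))) τ := by
  have hA := sub_pos.2 (sechMinSq_lt hw)
  have hU := sub_pos.2 (sechMinSq_lt_sechLine_sq hw hτ)
  have hD := Real.sqrt_pos.2 hA
  have hV := Real.sqrt_pos.2 hU
  have h1 := hasDerivAt_sechLine hw hτ
  have h2 := hasDerivAt_sechLineDeriv hw hτ
  have h3 := (((h1.pow 2).sub_const (sechMinSq w)).sqrt hU.ne').const_mul
    (√(sechCircle w 0 ^ 2 - sechMinSq w))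
  have h4 := (h2.const_mul 2).div h3 (mul_pos hD hV).ne'
  refine h4.congr_deriv ?_
  have hV2 := Real.sq_sqrt hU.le
  have hs := sechLineDeriv_sq hw hτ
  simp only [Pi.pow_apply, Nat.cast_ofNat, Nat.add_one_sub_one, pow_one]
  set V := √(sechLine w τ ^ 2 - sechMinSq w)
  set D := √(sechCircle w 0 ^ 2 - sechMinSq w)
  set g := sechLine w τ
  set p := sechLineDeriv w τ
  have hb : sechMinSq w = g ^ 2 - V ^ 2 := by linarith
  rw [hb] at hs ⊢
  field_simp
  have hs' : p ^ 2 = (g ^ 2 - sechCircle w 0 ^ 2) * V ^ 2 / 4 := by rw [hs]; ring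
  rw [hs']
  ring

lemma hasDerivAt_ellipticF_arctan_sechTan {w τ : ℝ} (hw : 0 < w) (hτ : |τ| < w) :
    HasDerivAt (fun t => ellipticF √(1 - sechModulus w ^ 2) (Real.arctan (sechTan w t)))
      (sechCircle w 0 / 2) τ := by
  have h0 := sechCircle_zero_pos hw
  have hB := sechMinSq_pos hw
  have hk : √(1 - sechModulus w ^ 2) ^ 2 = sechMinSq w / sechCircle w 0 ^ 2 := by
    rw [Real.sq_sqrt (by linarith [sechModulus_sq_lt_one hw]), sechModulus_sq hw]; ring
  have hk1 : √(1 - sechModulus w ^ 2) ^ 2 < 1 := by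
    rw [hk, div_lt_one (by positivity)]; exact sechMinSq_lt hw
  have hA := sub_pos.2 (sechMinSq_lt hw)
  have hU := sub_pos.2 (sechMinSq_lt_sechLine_sq hw hτ)
  have hg : 0 < sechLine w τ := h0.trans_le (sechCircle_zero_le_sechLine hw hτ)
  refine ((hasDerivAt_ellipticF hk1 _).comp τ (hasDerivAt_sechTan hw hτ).arctan).congr_deriv ?_
  have hT := sechTan_sq hw hτ
  have hsin : Real.sin (Real.arctan (sechTan w τ)) ^ 2 =
      sechTan w τ ^ 2 / (1 + sechTan w τ ^ 2) := by
    rw [Real.sin_arctan, div_pow, Real.sq_sqrt (by positivity)]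
  have h1T : 1 + sechTan w τ ^ 2 =
      (sechLine w τ ^ 2 - sechMinSq w) / (sechCircle w 0 ^ 2 - sechMinSq w) := by
    rw [hT]; field_simp; ring
  have hint : 1 - √(1 - sechModulus w ^ 2) ^ 2 * Real.sin (Real.arctan (sechTan w τ)) ^ 2 =
      (sechLine w τ * √(sechCircle w 0 ^ 2 - sechMinSq w) /
        (sechCircle w 0 * √(sechLine w τ ^ 2 - sechMinSq w))) ^ 2 := by
    rw [hk, hsin, h1T, hT, div_pow, mul_pow, mul_pow, Real.sq_sqrt hA.le, Real.sq_sqrt hU.le]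
    field_simp
    ring
  have hD := Real.sqrt_pos.2 hA
  have hV := Real.sqrt_pos.2 hU
  have hD2 := Real.sq_sqrt hA.le
  have hV2 := Real.sq_sqrt hU.le
  rw [ellipticIntegrand, hint, Real.sqrt_sq (by positivity), h1T]
  rw [← hD2, ← hV2, Real.sqrt_sq hV.le, Real.sqrt_sq hD.le]
  field_simp

lemma ellipticF_arctan_sechTan {w τ : ℝ} (hw : 0 < w) (hτ : |τ| < w) :
    ellipticF √(1 - sechModulus w ^ 2) (Real.arctan (sechTan w τ)) = sechCircle w 0 / 2 * τ := by
  have hd : ∀ t ∈ Set.Ioo (-w) w, HasDerivAt (fun t =>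
      ellipticF √(1 - sechModulus w ^ 2) (Real.arctan (sechTan w t)) -
        sechCircle w 0 / 2 * t) 0 t := fun t ht => by
    have := (hasDerivAt_ellipticF_arctan_sechTan hw (abs_lt.2 ht)).sub
      ((hasDerivAt_id t).const_mul (sechCircle w 0 / 2))
    refine this.congr_deriv ?_
    ring
  have := isOpen_Ioo.is_const_of_deriv_eq_zero isPreconnected_Ioo
    (fun t ht => (hd t ht).differentiableAt.differentiableWithinAt) (fun t ht => (hd t ht).deriv)
    (abs_lt.1 hτ) (Set.mem_Ioo.2 ⟨neg_lt_zero.2 hw, hw⟩)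
  have h0 : sechTan w 0 = 0 := by
    have := sechLineDeriv_neg w 0
    rw [neg_zero] at this
    rw [sechTan, show sechLineDeriv w 0 = 0 by linarith]
    simp
  simp only [h0, Real.arctan_zero, ellipticF_zero] at this
  linarith

lemma tendsto_sechLine {w : ℝ} (hw : 0 < w) : Tendsto (sechLine w) (𝓝[<] w) atTop := by
  have hev : ∀ᶠ τ in 𝓝[<] w, |τ| < w := by
    have h : ∀ᶠ τ : ℝ in 𝓝[<] w, -w < τ :=
      Filter.Eventually.filter_mono inf_le_left (Ioi_mem_nhds (by linarith))
    filter_upwards [self_mem_nhdsWithin, h] with τ h1 h2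
    exact abs_lt.2 ⟨h2, h1⟩
  refine tendsto_atTop.2 fun b => ?_
  obtain ⟨N, hN⟩ := exists_nat_gt b
  -- At `τ = w` each of the terms with `n ≥ 0` is at least one.
  have hlim : Tendsto (fun τ => ∑ n ∈ Finset.range N, sech w n * Real.exp ((n : ℝ) * τ)) (𝓝[<] w)
      (𝓝 (∑ n ∈ Finset.range N, sech w n * Real.exp ((n : ℝ) * w))) := by
    have : Continuous fun τ => ∑ n ∈ Finset.range N, sech w n * Real.exp ((n : ℝ) * τ) := by
      fun_prop
    exact (this.tendsto w).mono_left inf_le_left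
  have hterm : (N : ℝ) ≤ ∑ n ∈ Finset.range N, sech w n * Real.exp ((n : ℝ) * w) := by
    have : ∑ n ∈ Finset.range N, (1 : ℝ) ≤
        ∑ n ∈ Finset.range N, sech w n * Real.exp ((n : ℝ) * w) := by
      refine Finset.sum_le_sum fun n _ => ?_
      have h1 := Real.cosh_pos (w * n)
      rw [sech, Int.cast_natCast, one_div, inv_mul_eq_div, le_div_iff₀ h1, Real.cosh_eq, one_mul,
        mul_comm (n : ℝ) w]
      have : Real.exp (-(w * n)) ≤ Real.exp (w * n) :=
        Real.exp_le_exp.2 (by have : 0 ≤ w * n := by positivity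
                              linarith)
      linarith
    simpa using this
  filter_upwards [hev, hlim.eventually_const_lt (hN.trans_le hterm)] with τ h1 h2
  refine h2.le.trans ?_
  have h := sum_le_hasSum ((Finset.range N).map Nat.castEmbedding)
    (fun n _ => by have := sech_pos w n; positivity) (hasSum_sechLine hw h1)
  simpa using h

/-- As `τ → w` the function `g` tends to infinity, so the amplitude tends to `π / 2` and
`F(k', π/2) = K'(k)`. -/
lemma ellipticK'_sechModulus {w : ℝ} (hw : 0 < w) :
    ellipticK' (sechModulus w) = sechCircle w 0 / 2 * w := by
  have h0 := sechCircle_zero_pos hw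
  have hA := sub_pos.2 (sechMinSq_lt hw)
  have hD := Real.sqrt_pos.2 hA
  have hk1 : √(1 - sechModulus w ^ 2) ^ 2 < 1 := by
    rw [Real.sq_sqrt (by linarith [sechModulus_sq_lt_one hw])]
    have := pow_pos (sechModulus_mem hw).1 2
    linarith
  have hev : ∀ᶠ τ in 𝓝[<] w, 0 ≤ τ ∧ |τ| < w := by
    have h : ∀ᶠ τ : ℝ in 𝓝[<] w, 0 < τ :=
      Filter.Eventually.filter_mono inf_le_left (Ioi_mem_nhds hw)
    filter_upwards [self_mem_nhdsWithin, h] with τ h1 h2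
    exact ⟨h2.le, abs_lt.2 ⟨by linarith, h1⟩⟩
  have hT : Tendsto (sechTan w) (𝓝[<] w) atTop := by
    have hlow : Tendsto (fun τ => (sechLine w τ - sechCircle w 0) /
        √(sechCircle w 0 ^ 2 - sechMinSq w)) (𝓝[<] w) atTop :=
      (tendsto_atTop_add_const_right _ _ (tendsto_sechLine hw)).atTop_div_const hD
    refine tendsto_atTop_mono' _ ?_ hlow
    filter_upwards [hev] with τ hτ
    have hnn : 0 ≤ sechTan w τ :=
      div_nonneg (mul_nonneg zero_le_two (sechLineDeriv_nonneg hw hτ.2 hτ.1)) (by positivity)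
    have hge := sechCircle_zero_le_sechLine hw hτ.2
    refine le_of_sq_le_sq ?_ hnn
    rw [sechTan_sq hw hτ.2, div_pow, Real.sq_sqrt hA.le]
    exact div_le_div_of_nonneg_right (by nlinarith) hA.le
  have h1 : Tendsto (fun τ => ellipticF √(1 - sechModulus w ^ 2) (Real.arctan (sechTan w τ)))
      (𝓝[<] w) (𝓝 (ellipticK' (sechModulus w))) :=
    ((continuous_ellipticF hk1).tendsto _).comp
      ((Real.tendsto_arctan_atTop.mono_right inf_le_left).comp hT)
  have h2 : Tendsto (fun τ => sechCircle w 0 / 2 * τ) (𝓝[<] w) (𝓝 (sechCircle w 0 / 2 * w)) :=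
    ((continuous_const.mul continuous_id).tendsto w).mono_left inf_le_left
  refine tendsto_nhds_unique (h1.congr' ?_) h2
  filter_upwards [hev] with τ hτ
  exact ellipticF_arctan_sechTan hw hτ.2

/-! ### The modulus belonging to `w` -/

lemma eq_pi_mul_ellipticK'_div {w : ℝ} (hw : 0 < w) :
    w = Real.pi * ellipticK' (sechModulus w) / ellipticK (sechModulus w) := by
  have h0 := sechCircle_zero_pos hw
  have hπ := Real.pi_pos
  rw [ellipticK'_sechModulus hw, ellipticK_sechModulus hw]
  field_simp

lemma ellipticK'_lt_ellipticK' {k l : ℝ} (hk : 0 < k) (hkl : k < l) (hl : l < 1) :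
    ellipticK' l < ellipticK' k := by
  refine ellipticK_lt_ellipticK (Real.sqrt_nonneg _) (Real.sqrt_lt_sqrt ?_ ?_) ?_
  · nlinarith
  · nlinarith
  · rw [Real.sqrt_lt' one_pos]
    nlinarith

lemma ellipticK'_div_ellipticK_lt {k l : ℝ} (hk : 0 < k) (hkl : k < l) (hl : l < 1) :
    ellipticK' l / ellipticK l < ellipticK' k / ellipticK k := by
  have h1 := ellipticK'_lt_ellipticK' hk hkl hl
  have h2 := ellipticK_lt_ellipticK hk.le hkl hl
  have h3 := ellipticK_pos (k := k) (by nlinarith)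
  have h4 : 0 < ellipticK' l := ellipticK_pos (by
    rw [Real.sq_sqrt (by nlinarith)]; nlinarith)
  exact div_lt_div₀ h1 h2.le (h4.trans h1).le h3

lemma eq_sechModulus {w k : ℝ} (hw : 0 < w) (hk : k ∈ Set.Ioo (0 : ℝ) 1)
    (h : w = Real.pi * ellipticK' k / ellipticK k) : k = sechModulus w := by
  have h1 := eq_pi_mul_ellipticK'_div hw
  have hm := sechModulus_mem hw
  have h2 : ellipticK' k / ellipticK k =
      ellipticK' (sechModulus w) / ellipticK (sechModulus w) := by
    rw [mul_div_assoc] at h h1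
    exact mul_left_cancel₀ Real.pi_pos.ne' (h ▸ h1)
  rcases lt_trichotomy k (sechModulus w) with hlt | heq | hgt
  · exact absurd h2 (ellipticK'_div_ellipticK_lt hk.1 hlt hm.2).ne'
  · exact heq
  · exact absurd h2 (ellipticK'_div_ellipticK_lt hm.1 hgt hk.2).ne

/-! ### Moments and orthogonality on the circle -/

section

variable {w : ℝ} (hw : 0 < w)
include hw

lemma continuous_dnWeight_sechModulus : Continuous (dnWeight (sechModulus w)) := by
  have : dnWeight (sechModulus w) = fun θ => sechCircle w θ / (2 * Real.pi) :=
    funext (dnWeight_sechModulus hw)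
  rw [this]
  exact (continuous_sechCircle hw).div_const _

lemma integral_exp_mul_dnWeight (m : ℤ) :
    ∫ θ in (0 : ℝ)..(2 * Real.pi),
      Complex.exp (m * θ * Complex.I) * (dnWeight (sechModulus w) θ : ℂ) = sech w m := by
  have hπ : (Real.pi : ℂ) ≠ 0 := Complex.ofReal_ne_zero.2 Real.pi_ne_zero
  have h : ∀ θ : ℝ, Complex.exp (m * θ * Complex.I) * (dnWeight (sechModulus w) θ : ℂ) =
      ((sechCircle w θ : ℂ) * Complex.exp (m * θ * Complex.I)) / (2 * Real.pi) := fun θ => by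
    rw [dnWeight_sechModulus hw]
    push_cast
    ring
  simp only [h]
  rw [intervalIntegral.integral_div, integral_sechCircle_mul_exp hw]
  field_simp

lemma integral_dnWeight_mul_cos (m : ℤ) :
    ∫ θ in (0 : ℝ)..(2 * Real.pi), dnWeight (sechModulus w) θ * Real.cos (m * θ) = sech w m := by
  have hc := continuous_dnWeight_sechModulus hw
  have hint : IntervalIntegrable (fun θ : ℝ => Complex.exp (m * θ * Complex.I) *
      (dnWeight (sechModulus w) θ : ℂ)) volume 0 (2 * Real.pi) := by
    refine Continuous.intervalIntegrable ?_ _ _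
    fun_prop
  have h := Complex.reCLM.intervalIntegral_comp_comm hint
  rw [integral_exp_mul_dnWeight hw] at h
  simp only [Complex.reCLM_apply, Complex.ofReal_re] at h
  rw [← h]
  refine intervalIntegral.integral_congr fun θ _ => ?_
  have e : (m : ℂ) * θ * Complex.I = ((m * θ : ℝ) : ℂ) * Complex.I := by push_cast; ring
  simp only [e, Complex.re_mul_ofReal, Complex.exp_ofReal_mul_I_re]
  ring

lemma sum_limitCoeff_mul_sum (n m : ℕ) :
    ∑ s ∈ Finset.range (n + 1), ∑ j ∈ Finset.range (m + 1),
      limitCoeff w n s * limitCoeff w m j * sech w ((s : ℤ) - j) =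
      if n = m then tanhProd w n ^ 2 else 0 := by
  have hmom : ∀ N M : ℕ, M ≤ N → ∑ s ∈ Finset.range (N + 1), ∑ j ∈ Finset.range (M + 1),
      limitCoeff w N s * limitCoeff w M j * sech w ((s : ℤ) - j) =
      if N = M then tanhProd w N ^ 2 else 0 := by
    intro N M hMN
    have h1 : ∑ s ∈ Finset.range (N + 1), ∑ j ∈ Finset.range (M + 1),
        limitCoeff w N s * limitCoeff w M j * sech w ((s : ℤ) - j) =
        ∑ j ∈ Finset.range (M + 1), limitCoeff w M j *
          momentFunctional (sech w) (cnPoly 1 w N) j := by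
      rw [Finset.sum_comm]
      refine Finset.sum_congr rfl fun j _ => ?_
      rw [momentFunctional_cnPoly_one hw, Finset.mul_sum]
      exact Finset.sum_congr rfl fun s _ => by ring
    have h2 : ∀ j ∈ Finset.range M, limitCoeff w M j *
        momentFunctional (sech w) (cnPoly 1 w N) j = 0 := fun j hj => by
      rw [momentFunctional_sech_of_lt hw (c := sech w) (fun _ => rfl) ((Finset.mem_range.1 hj).trans_le hMN),
        mul_zero]
    rw [h1, Finset.sum_range_succ, Finset.sum_eq_zero h2, zero_add, limitCoeff_self hw, one_mul]
    split_ifs with h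
    · rw [← h, momentFunctional_sech_self hw (c := sech w) fun _ => rfl]
    · exact momentFunctional_sech_of_lt hw (c := sech w) (fun _ => rfl) (lt_of_le_of_ne hMN (Ne.symm h))
  rcases le_total m n with h | h
  · exact hmom n m h
  · rw [Finset.sum_comm]
    have h1 := hmom m n h
    rw [show (if n = m then tanhProd w n ^ 2 else 0) = if m = n then tanhProd w m ^ 2 else 0 by
      by_cases hnm : n = m
      · simp [hnm]
      · simp [hnm, Ne.symm hnm], ← h1]
    refine Finset.sum_congr rfl fun s _ => Finset.sum_congr rfl fun j _ => ?_
    rw [← sech_neg w ((s : ℤ) - j), neg_sub]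
    ring

lemma integral_cnPoly_one_mul (n m : ℕ) :
    ∫ θ in (0 : ℝ)..(2 * Real.pi),
      Polynomial.aeval (Complex.exp ((θ : ℂ) * Complex.I)) (cnPoly 1 w n) *
      Polynomial.aeval (Complex.exp (-((θ : ℂ) * Complex.I))) (cnPoly 1 w m) *
      ((dnWeight (sechModulus w) θ : ℝ) : ℂ) =
      if n = m then ((∏ j ∈ Finset.range n, Real.tanh (w * ((j : ℝ) + 1)) ^ 2 : ℝ) : ℂ)
      else 0 := by
  have hc := continuous_dnWeight_sechModulus hw
  have hexpand : ∀ θ : ℝ,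
      Polynomial.aeval (Complex.exp ((θ : ℂ) * Complex.I)) (cnPoly 1 w n) *
      Polynomial.aeval (Complex.exp (-((θ : ℂ) * Complex.I))) (cnPoly 1 w m) *
      ((dnWeight (sechModulus w) θ : ℝ) : ℂ) =
      ∑ s ∈ Finset.range (n + 1), ∑ j ∈ Finset.range (m + 1),
        ((limitCoeff w n s * limitCoeff w m j : ℝ) : ℂ) *
          (Complex.exp (((s : ℤ) - j : ℤ) * θ * Complex.I) *
            ((dnWeight (sechModulus w) θ : ℝ) : ℂ)) := by
    intro θ
    rw [aeval_cnPoly_one hw, aeval_cnPoly_one hw, Finset.sum_mul_sum, Finset.sum_mul]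
    refine Finset.sum_congr rfl fun s _ => ?_
    rw [Finset.sum_mul]
    refine Finset.sum_congr rfl fun j _ => ?_
    rw [show (((s : ℤ) - j : ℤ) : ℂ) * θ * Complex.I =
      s * (θ * Complex.I) + j * (-(θ * Complex.I)) by push_cast; ring, Complex.exp_add,
      Complex.exp_nat_mul, Complex.exp_nat_mul]
    push_cast
    ring
  simp only [hexpand]
  rw [intervalIntegral.integral_finsetSum]
  · have h1 : ∀ s ∈ Finset.range (n + 1), (∫ θ in (0 : ℝ)..(2 * Real.pi),
        ∑ j ∈ Finset.range (m + 1), ((limitCoeff w n s * limitCoeff w m j : ℝ) : ℂ) *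
          (Complex.exp (((s : ℤ) - j : ℤ) * θ * Complex.I) *
            ((dnWeight (sechModulus w) θ : ℝ) : ℂ))) =
        ∑ j ∈ Finset.range (m + 1),
          ((limitCoeff w n s * limitCoeff w m j * sech w ((s : ℤ) - j) : ℝ) : ℂ) := by
      intro s _
      rw [intervalIntegral.integral_finsetSum]
      · refine Finset.sum_congr rfl fun j _ => ?_
        rw [intervalIntegral.integral_const_mul, integral_exp_mul_dnWeight hw]
        push_cast
        ring
      · intro j _
        refine Continuous.intervalIntegrable ?_ _ _
        fun_prop
    rw [Finset.sum_congr rfl h1, Finset.prod_pow]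
    have h2 := congrArg (fun x : ℝ => (x : ℂ)) (sum_limitCoeff_mul_sum hw n m)
    push_cast at h2 ⊢
    rw [h2]
    split_ifs <;> simp [tanhProd]
  · intro s _
    refine Continuous.intervalIntegrable ?_ _ _
    fun_prop

/-! ### The measure on the circle -/

lemma isFiniteMeasure_circleWeightMeasure :
    IsFiniteMeasure (circleWeightMeasure (dnWeight (sechModulus w))) := by
  have hc := continuous_dnWeight_sechModulus hw
  have hint : Integrable (dnWeight (sechModulus w))
      (volume.restrict (Set.Ioc 0 (2 * Real.pi))) :=
    (hc.integrableOn_Icc (a := 0) (b := 2 * Real.pi)).mono_set Set.Ioc_subset_Icc_self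
  have : IsFiniteMeasure ((volume.restrict (Set.Ioc 0 (2 * Real.pi))).withDensity
      (fun θ => ENNReal.ofReal (dnWeight (sechModulus w) θ))) :=
    isFiniteMeasure_withDensity_ofReal hint.2
  unfold circleWeightMeasure
  infer_instance

lemma integral_zpow_circleWeightMeasure (m : ℤ) :
    ∫ z, z ^ m ∂circleWeightMeasure (dnWeight (sechModulus w)) = (sech w m : ℂ) := by
  have hc := continuous_dnWeight_sechModulus hw
  have hexp : Continuous fun θ : ℝ => Complex.exp ((θ : ℂ) * Complex.I) := by fun_prop
  have hz : Measurable fun z : ℂ => z ^ m := by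
    rcases m with m | m
    · simpa using (measurable_id (α := ℂ)).pow_const m
    · simp only [zpow_negSucc]
      exact ((measurable_id (α := ℂ)).pow_const (m + 1)).inv
  rw [circleWeightMeasure, integral_map hexp.aemeasurable hz.aestronglyMeasurable,
    integral_withDensity_eq_integral_toReal_smul
      (hc.measurable.ennreal_ofReal) (by simp), ← integral_exp_mul_dnWeight hw m,
    intervalIntegral.integral_of_le (by positivity)]
  refine integral_congr_ae (Eventually.of_forall fun θ => ?_)
  have hpos : 0 ≤ dnWeight (sechModulus w) θ := by
    rw [dnWeight_sechModulus hw]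
    exact (div_pos (sechCircle_pos hw θ) (by positivity)).le
  simp only [ENNReal.toReal_ofReal hpos, Complex.real_smul, ← Complex.exp_int_mul]
  rw [mul_comm, mul_assoc]

omit hw in
lemma circleWeightMeasure_compl_sphere (ρ : ℝ → ℝ) :
    circleWeightMeasure ρ (Metric.sphere (0 : ℂ) 1)ᶜ = 0 := by
  have hexp : Continuous fun θ : ℝ => Complex.exp ((θ : ℂ) * Complex.I) := by fun_prop
  rw [circleWeightMeasure, Measure.map_apply hexp.measurable
    (Metric.isClosed_sphere.measurableSet.compl)]
  convert measure_empty (μ := (volume.restrict (Set.Ioc 0 (2 * Real.pi))).withDensity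
    (fun θ => ENNReal.ofReal (ρ θ)))
  ext θ
  simp [Complex.norm_exp_ofReal_mul_I]

end

/-- A finite measure on a circle `ℝ / Tℤ` is determined by its Fourier coefficients, since the
trigonometric polynomials are dense in the continuous functions. -/
lemma addCircle_measure_ext {T : ℝ} [hT : Fact (0 < T)] {μ ν : Measure (AddCircle T)}
    [IsFiniteMeasure μ] [IsFiniteMeasure ν]
    (h : ∀ n : ℤ, ∫ x, fourier n x ∂μ = ∫ x, fourier n x ∂ν) : μ = ν := by
  have hint : ∀ (κ : Measure (AddCircle T)) [IsFiniteMeasure κ] (g : C(AddCircle T, ℂ)),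
      Integrable g κ := fun κ _ g =>
    Integrable.of_bound g.continuous.aestronglyMeasurable ‖g‖
      (Eventually.of_forall fun x => g.norm_coe_le_norm x)
  let L : ∀ (κ : Measure (AddCircle T)) [IsFiniteMeasure κ], C(AddCircle T, ℂ) →L[ℂ] ℂ := fun κ _ =>
    LinearMap.mkContinuous
      { toFun := fun g => ∫ x, g x ∂κ
        map_add' := fun f g => integral_add (hint κ f) (hint κ g)
        map_smul' := fun c f => integral_const_mul c _ }
      (κ.real Set.univ) fun g => by
        rw [mul_comm]
        exact norm_integral_le_of_norm_le_const (Eventually.of_forall fun x => g.norm_coe_le_norm x)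
  have hL : L μ = L ν := by
    refine ContinuousLinearMap.ext_on (s := Set.range (@fourier T)) ?_ ?_
    · have := span_fourier_closure_eq_top (T := T)
      rw [Submodule.dense_iff_topologicalClosure_eq_top]
      exact this
    · rintro _ ⟨n, rfl⟩
      exact h n
  refine ext_of_forall_integral_eq_of_IsFiniteMeasure fun f => ?_
  have hf := congrArg (fun M => M ⟨fun x => (f x : ℂ), by fun_prop⟩) hL
  change ∫ x, (f x : ℂ) ∂μ = ∫ x, (f x : ℂ) ∂ν at hf
  rw [integral_complex_ofReal, integral_complex_ofReal] at hf
  exact_mod_cast hf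

/-- A finite measure on the unit circle is determined by its moments. -/
lemma unitCircle_measure_ext {μ ν : Measure ℂ} [IsFiniteMeasure μ] [IsFiniteMeasure ν]
    (hμ : μ (Metric.sphere (0 : ℂ) 1)ᶜ = 0) (hν : ν (Metric.sphere (0 : ℂ) 1)ᶜ = 0)
    (h : ∀ m : ℤ, ∫ z, z ^ m ∂μ = ∫ z, z ^ m ∂ν) : μ = ν := by
  have : Fact (0 < 2 * Real.pi) := ⟨Real.two_pi_pos⟩
  let p : ℂ → AddCircle (2 * Real.pi) := fun z => ((Complex.arg z : ℝ) : AddCircle (2 * Real.pi))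
  have hp : Measurable p :=
    (AddCircle.continuous_mk' (2 * Real.pi)).measurable.comp Complex.measurable_arg
  have hfour : ∀ (n : ℤ) (z : ℂ), fourier n (p z) = Complex.exp (Complex.arg z * Complex.I) ^ n := by
    intro n z
    have hπ : (Real.pi : ℂ) ≠ 0 := Complex.ofReal_ne_zero.2 Real.pi_ne_zero
    rw [fourier_coe_apply, ← Complex.exp_int_mul]
    congr 1
    push_cast
    field_simp
  have hexp : ∀ κ : Measure ℂ, κ (Metric.sphere (0 : ℂ) 1)ᶜ = 0 →
      ∀ᵐ z ∂κ, Complex.exp (Complex.arg z * Complex.I) = z := by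
    intro κ hκ
    have : ∀ᵐ z ∂κ, z ∈ Metric.sphere (0 : ℂ) 1 := by
      rw [ae_iff]; exact hκ
    filter_upwards [this] with z hz
    have h1 := Complex.norm_mul_exp_arg_mul_I z
    rw [mem_sphere_zero_iff_norm.1 hz, Complex.ofReal_one, one_mul] at h1
    exact h1
  have hcoef : ∀ κ : Measure ℂ, κ (Metric.sphere (0 : ℂ) 1)ᶜ = 0 → ∀ n : ℤ,
      ∫ x, fourier n x ∂(κ.map p) = ∫ z, z ^ n ∂κ := by
    intro κ hκ n
    rw [integral_map hp.aemeasurable (fourier n).continuous.aestronglyMeasurable]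
    refine integral_congr_ae ?_
    filter_upwards [hexp κ hκ] with z hz
    rw [hfour, hz]
  have hmap : μ.map p = ν.map p := addCircle_measure_ext fun n => by
    rw [hcoef μ hμ, hcoef ν hν, h n]
  have hback : ∀ κ : Measure ℂ, κ (Metric.sphere (0 : ℂ) 1)ᶜ = 0 →
      (κ.map p).map (fun x => fourier 1 x) = κ := by
    intro κ hκ
    rw [Measure.map_map (fourier 1).continuous.measurable hp]
    have : (fun x => fourier 1 x) ∘ p =ᵐ[κ] id := by
      filter_upwards [hexp κ hκ] with z hz
      simp only [Function.comp, hfour, zpow_one, hz, id]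
    rw [Measure.map_congr this, Measure.map_id]
  rw [← hback μ hμ, ← hback ν hν, hmap]

lemma moments_eq_iff {w : ℝ} (hw : 0 < w) (μ : Measure ℂ) [IsFiniteMeasure μ]
    (hμ : μ (Metric.sphere (0 : ℂ) 1)ᶜ = 0) :
    (∀ m : ℤ, ∫ z, z ^ m ∂μ = (sech w m : ℂ)) ↔
      μ = circleWeightMeasure (dnWeight (sechModulus w)) := by
  have := isFiniteMeasure_circleWeightMeasure hw
  constructor
  · intro h
    exact unitCircle_measure_ext hμ (circleWeightMeasure_compl_sphere _) fun m => by
      rw [h m, integral_zpow_circleWeightMeasure hw]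
  · rintro rfl m
    exact integral_zpow_circleWeightMeasure hw m

theorem proposition6 (w : ℝ) (hw : 0 < w) :
    -- At `k = 1` the cn- and the dn-polynomials coincide, and both families tend to this common
    -- family, coefficient by coefficient, as the modulus tends to 1 from below.
    (∀ n : ℕ, cnPoly 1 w n = dnPoly 1 w n) ∧
    (∀ n s : ℕ,
      Tendsto (fun k : ℝ => (cnPoly k w n).coeff s) (𝓝[<] 1) (𝓝 ((cnPoly 1 w n).coeff s)) ∧
      Tendsto (fun k : ℝ => (dnPoly k w n).coeff s) (𝓝[<] 1) (𝓝 ((cnPoly 1 w n).coeff s))) ∧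
    -- The moments `cn(wm; k)` and `dn(wm; k)` become `1 / cosh(wm)`.
    (∀ m : ℤ,
      jacobiCn 1 (w * m) = 1 / Real.cosh (w * m) ∧
      jacobiDn 1 (w * m) = 1 / Real.cosh (w * m) ∧
      Tendsto (fun k : ℝ => jacobiCn k (w * m)) (𝓝[<] 1) (𝓝 (1 / Real.cosh (w * m))) ∧
      Tendsto (fun k : ℝ => jacobiDn k (w * m)) (𝓝[<] 1) (𝓝 (1 / Real.cosh (w * m)))) ∧
    -- The limit polynomials are monic of degree `n`, with the stated reflection parameters.
    (∀ n : ℕ, (cnPoly 1 w n).Monic ∧ (cnPoly 1 w n).natDegree = n ∧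
      -(cnPoly 1 w (n + 1)).coeff 0 = (-1 : ℝ) ^ n / Real.cosh (w * ((n : ℝ) + 1))) ∧
    -- Their moments are exactly `1 / cosh(wm)`.
    (∀ c : ℤ → ℝ,
      IsMomentSequence (cnPoly 1 w) c ↔ ∀ m : ℤ, c m = 1 / Real.cosh (w * m)) ∧
    -- The basic hypergeometric form, with `q = exp(-2w)`.
    (∀ q : ℝ, q = Real.exp (-2 * w) → ∀ (n : ℕ) (z : ℂ),
      Polynomial.aeval z (cnPoly 1 w n) =
        2 * (-1 : ℂ) ^ n * ((q ^ (-(n : ℝ) / 2) : ℝ) : ℂ) / (1 + (q : ℂ) ^ (-(n : ℤ))) *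
          basicHypergeom21 q ((q : ℂ) ^ (-(n : ℤ))) (-(q : ℂ)) (-(q : ℂ) ^ (1 - (n : ℤ)))
            (z * ((q ^ (1 / 2 : ℝ) : ℝ) : ℂ))) ∧
    -- The modulus is fixed by `w = π K'(k) / K(k)`.
    (∃! k : ℝ, k ∈ Set.Ioo (0 : ℝ) 1 ∧ w = Real.pi * ellipticK' k / ellipticK k) ∧
    -- The weight function.
    (∀ k ∈ Set.Ioo (0 : ℝ) 1, w = Real.pi * ellipticK' k / ellipticK k →
      Continuous (dnWeight k) ∧
      (∀ θ : ℝ, 0 < dnWeight k θ) ∧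
      (∀ θ : ℝ, dnWeight k (2 * Real.pi - θ) = dnWeight k θ) ∧
      -- It reproduces the moments,
      (∀ m : ℤ, (∫ θ in (0 : ℝ)..(2 * Real.pi), dnWeight k θ * Real.cos (m * θ)) =
        1 / Real.cosh (w * m)) ∧
      -- the polynomials are orthogonal with respect to it,
      (∀ n m : ℕ, (∫ θ in (0 : ℝ)..(2 * Real.pi),
          Polynomial.aeval (Complex.exp ((θ : ℂ) * Complex.I)) (cnPoly 1 w n) *
          Polynomial.aeval (Complex.exp (-((θ : ℂ) * Complex.I))) (cnPoly 1 w m) *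
          ((dnWeight k θ : ℝ) : ℂ)) =
        if n = m then ((∏ j ∈ Finset.range n, Real.tanh (w * ((j : ℝ) + 1)) ^ 2 : ℝ) : ℂ)
        else 0) ∧
      -- and `ρ(θ) dθ` is the only finite measure on the unit circle with these moments.
      (∀ μ : Measure ℂ, IsFiniteMeasure μ → μ (Metric.sphere (0 : ℂ) 1)ᶜ = 0 →
        ((∀ m : ℤ, (∫ z, z ^ m ∂μ) = ((1 / Real.cosh (w * m) : ℝ) : ℂ)) ↔
          μ = circleWeightMeasure (dnWeight k)))) := by
  refine ⟨fun n => (dnPoly_one w n).symm,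
    fun n s => ⟨tendsto_coeff_cnPoly hw n s, tendsto_coeff_dnPoly hw n s⟩,
    fun m => ⟨jacobiCn_one _, jacobiDn_one _, tendsto_jacobiCn_one _, tendsto_jacobiDn_one _⟩,
    fun n => ⟨monic_cnPoly_one hw n, natDegree_cnPoly_one hw n, ?_⟩,
    isMomentSequence_cnPoly_one_iff hw,
    fun q hq n z => aeval_cnPoly_one_eq_basicHypergeom21 hw hq n z,
    ⟨sechModulus w, ⟨sechModulus_mem hw, eq_pi_mul_ellipticK'_div hw⟩,
      fun k hk => eq_sechModulus hw hk.1 hk.2⟩, ?_⟩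
  · rw [coeff_cnPoly_one hw (Nat.zero_le _), limitCoeff_zero hw, pow_succ]
    push_cast
    ring
  · intro k hk hwk
    obtain rfl := eq_sechModulus hw hk hwk
    refine ⟨continuous_dnWeight_sechModulus hw, fun θ => ?_, fun θ => ?_,
      integral_dnWeight_mul_cos hw, integral_cnPoly_one_mul hw, fun μ _ hμ => moments_eq_iff hw μ hμ⟩
    · rw [dnWeight_sechModulus hw]
      exact div_pos (sechCircle_pos hw θ) (by positivity)
    · rw [dnWeight_sechModulus hw, dnWeight_sechModulus hw, sechCircle_two_pi_sub hw]
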